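/- A frequency is a strictly increasing sequence $\lambda=(\lambda_n)_{n\ge 1}$ of nonnegative real numbers tending to $+\infty$. It satisfies (NC) if for all $\delta>0$ there exists $C>0$ such that for all $n\ge1$ there exists $m>n$ with $$\log\left(\frac{\lambda_m+\lambda_n}{\lambda_m-\lambda_n}\right)+(m-n)\le Ce^{\delta\lambda_n}.$$ A $\lambda$-Dirichlet group is a pair $(G,\beta)$, where $G$ is a compact (Hausdorff) abelian group and $\beta:(\mathbb R,+)\to G$ is a continuous homomorphism with dense range, such that for every $n\ge 1$ there is a (necessarily unique) continuous character $h_{\lambda_n}\in\widehat G$ with $h_{\lambda_n}(\beta(t))=e^{-i\lambda_n t}$ for all $t\in\mathbb R$. The group $G$ carries its normalized Haar measure, $\hat f(\chi)=\int_G f\,\overline{\chi}$ for $f\in L_1(G)$ and $\chi\in\widehat G$, and, for $1\le p\le+\infty$, $H_p^\lambda(G)$ is the space of all $f\in L_p(G)$ such that $\hat f(\chi)=0$ for every $\chi\in\widehat G\setminus\{h_{\lambda_n}:n\ge1\}$. **Theorem.** Let $\lambda$ be a frequency satisfying (NC). For every $u>0$ there exists a constant $C=C(u,\lambda)>0$ such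 that, for every $\lambda$-Dirichlet group $(G,\beta)$, for all $1\le p\le+\infty$ and for all $f\in H_p^\lambda(G)$, $$\left\|\sup_{\sigma\ge u}\sup_{N}\left|\sum_{n=1}^N\hat f(h_{\lambda_n})e^{-\sigma\lambda_n}h_{\lambda_n}\right|\right\|_p\le C\|f\|_p .$$ In particular, for every $u>0$, every $\lambda$-Dirichlet group $(G,\beta)$, every $1\le p\le+\infty$ and every $f\in H_p^\lambda(G)$, the series $\sum_{n=1}^{+\infty}\hat f(h_{\lambda_n})e^{-u\lambda_n}h_{\lambda_n}$ converges almost everywhere on $G$. -/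

import Mathlib

open MeasureTheory Filter Topology
open scoped ENNReal

noncomputable section

namespace DirichletHardy

/-- A frequency `lam 0 < lam 1 < ...`: a strictly increasing sequence of nonnegative real numbers
tending to `+∞`. The term usually written `λ_n`, `n ≥ 1`, is `lam (n - 1)`. -/
structure IsFrequency (lam : ℕ → ℝ) : Prop where
  nonneg : ∀ n, 0 ≤ lam n
  strictMono : StrictMono lam
  tendsto_atTop : Tendsto lam atTop atTop

/-- Condition (NC) on a frequency. -/
def NC (lam : ℕ → ℝ) : Prop :=
  ∀ δ : ℝ, 0 < δ → ∃ C : ℝ, 0 < C ∧ ∀ n : ℕ, ∃ m : ℕ, n < m ∧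
    Real.log ((lam m + lam n) / (lam m - lam n)) + ((m : ℝ) - (n : ℝ))
      ≤ C * Real.exp (δ * lam n)

section Group

variable {G : Type*} [CommGroup G] [TopologicalSpace G]

/-- `(G, β)` is a `lam`-Dirichlet group: the continuous homomorphism `β : (ℝ, +) → G` has dense
range and, for each `n`, some character `h` of `G` satisfies `h (β t) = exp (-i lam_n t)` for all
real `t`. (Compactness of `G` is a type class assumption wherever the notion is used.) -/
structure IsDirichletGroup (lam : ℕ → ℝ) (β : Multiplicative ℝ →ₜ* G) : Prop where
  denseRange : DenseRange β
  exists_character : ∀ n : ℕ, ∃ h : PontryaginDual G, ∀ t : ℝ,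
    ((h (β (Multiplicative.ofAdd t)) : Circle) : ℂ)
      = Complex.exp (-Complex.I * (lam n : ℂ) * (t : ℂ))

namespace IsDirichletGroup

variable {lam : ℕ → ℝ} {β : Multiplicative ℝ →ₜ* G}

/-- The character `h_{lam_n}` of a `lam`-Dirichlet group; it is unique, see `eq_character`. -/
def character (hG : IsDirichletGroup lam β) (n : ℕ) : PontryaginDual G :=
  (hG.exists_character n).choose

theorem character_apply (hG : IsDirichletGroup lam β) (n : ℕ) (t : ℝ) :
    ((hG.character n (β (Multiplicative.ofAdd t)) : Circle) : ℂ)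
      = Complex.exp (-Complex.I * (lam n : ℂ) * (t : ℂ)) :=
  (hG.exists_character n).choose_spec t

theorem eq_character (hG : IsDirichletGroup lam β) (n : ℕ) (h : PontryaginDual G)
    (hh : ∀ t : ℝ, ((h (β (Multiplicative.ofAdd t)) : Circle) : ℂ)
      = Complex.exp (-Complex.I * (lam n : ℂ) * (t : ℂ))) :
    h = hG.character n := by
  have key : (h : G → Circle) = hG.character n := by
    refine hG.denseRange.equalizer (map_continuous h) (map_continuous _) ?_
    funext t
    apply Circle.ext
    have h1 := hh (Multiplicative.toAdd t)
    have h2 := hG.character_apply n (Multiplicative.toAdd t)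
    rw [ofAdd_toAdd] at h1 h2
    exact h1.trans h2.symm
  exact PontryaginDual.ext fun a => congrFun key a

end IsDirichletGroup

variable [MeasurableSpace G]

/-- The Fourier coefficient of `f` at the character `χ`, with respect to the measure `μ`. -/
def fourierCoefficient (μ : Measure G) (f : G → ℂ) (χ : PontryaginDual G) : ℂ :=
  ∫ ω, f ω * (starRingEnd ℂ) ((χ ω : Circle) : ℂ) ∂μ

variable {lam : ℕ → ℝ} {β : Multiplicative ℝ →ₜ* G}

/-- `f` belongs to the Hardy space `H_p^lam(G)`: it is in `L_p(G)` and its Fourier transform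
vanishes off the characters `h_{lam_n}`. -/
structure MemHardy (hG : IsDirichletGroup lam β) (μ : Measure G) (p : ℝ≥0∞) (f : G → ℂ) :
    Prop where
  memLp : MemLp f p μ
  spectrum : ∀ χ : PontryaginDual G, fourierCoefficient μ f χ ≠ 0 →
    χ ∈ Set.range hG.character

/-- The sum of the first `N` terms of `∑ f̂(h_{lam_n}) exp (-σ lam_n) h_{lam_n}` at `ω`. -/
def partialSum (hG : IsDirichletGroup lam β) (μ : Measure G) (f : G → ℂ) (σ : ℝ) (N : ℕ)
    (ω : G) : ℂ :=
  ∑ n ∈ Finset.range N, fourierCoefficient μ f (hG.character n) *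
    (Real.exp (-σ * lam n) : ℂ) * ((hG.character n ω : Circle) : ℂ)

/-- The maximal function `sup_{σ ≥ u} sup_N |partialSum σ N|`, with values in `[0, ∞]`. -/
def maximalFunction (hG : IsDirichletGroup lam β) (μ : Measure G) (f : G → ℂ) (u : ℝ)
    (ω : G) : ℝ≥0∞ :=
  ⨆ σ : Set.Ici u, ⨆ N : ℕ, ‖partialSum hG μ f σ N ω‖ₑ

end Group

end DirichletHardy

end

noncomputable section

set_option linter.unusedSectionVars false

namespace DirichletHardy

/-! Put `u = 2 * v`, let `c n` be the Fourier coefficients of `f` and `S n` the undamped sum of the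
terms of index at most `n`. Everything reduces to an `L_p` bound for the supremum over `n` of `exp
(-v * lam n) * |S n|`. Abel summation then controls all partial sums with `σ ≥ 2 * v` pointwise, and
yields convergence wherever this supremum is finite.

For a Dirichlet polynomial `D`, cut the spectrum smoothly. Let `m > n` come from (NC) and choose `b`
with `lam n < b ≤ lam m`. Averaging `D` along the flow `β` against the kernel `trapKernel (lam n) b`
multiplies the coefficients by a trapezoid equal to `1` up to `lam n` and to `0` from `b` on. It
therefore returns `S n` up to fewer than `m - n` terms, each at most the `L_1` norm of `D`. (NC) is
used twice. It bounds `exp (-v * lam n) * (m - n)`, and it prevents `b - lam n` from being too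
small, so that the damped kernels have one integrable majorant for all `n`
(`NC.exists_trapKernel_le`). The supremum over `n` is thus dominated by a single average of `|D|`
along the flow plus a multiple of its `L_1` norm (`dampedSum_le`). Translation invariance bounds
this on every `L_p`, endpoints included, with a constant independent of the group and of `p`.

A general `f` need not be a norm limit of polynomials when `p = ∞`. Convolution with normalized
products of Fejér kernels still gives polynomials of no larger norm whose first `N` coefficients are
close to those of `f` (`MemHardy.exists_dirichletPolynomial`). This suffices for the supremum over
`n < N`, and monotone convergence in `N` finishes. -/

/-! ### Trapezoidal kernels on the real line -/

/-- The function `t ↦ (1 - cos (c t)) / t ^ 2`. -/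
def fejer (c t : ℝ) : ℝ := (1 - Real.cos (c * t)) / t ^ 2

theorem fejer_nonneg (c t : ℝ) : 0 ≤ fejer c t :=
  div_nonneg (sub_nonneg.2 (Real.cos_le_one _)) (sq_nonneg _)

theorem integrable_fejer (c : ℝ) : Integrable (fejer c) := by
  have hm : Measurable (fejer c) := by unfold fejer; fun_prop
  refine (integrable_inv_one_add_sq.const_mul (c ^ 2 / 2 + 2)).mono' hm.aestronglyMeasurable ?_
  refine ae_of_all _ fun t => ?_
  rw [Real.norm_of_nonneg (fejer_nonneg c t), ← div_eq_mul_inv, le_div_iff₀ (by positivity)]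
  unfold fejer
  rcases eq_or_ne t 0 with rfl | ht
  · simp; positivity
  · have h1 := Real.one_sub_sq_div_two_le_cos (x := c * t)
    have h2 := Real.neg_one_le_cos (c * t)
    have ht2 : 0 < t ^ 2 := by positivity
    rw [div_mul_eq_mul_div, div_le_iff₀ ht2]
    nlinarith

/-- The integral of `fejer 1`; its value is `π`, but only its positivity matters. -/
def fejerMass : ℝ := ∫ t, fejer 1 t

theorem fejerMass_pos : 0 < fejerMass := by
  unfold fejerMass
  rw [integral_pos_iff_support_of_nonneg (fejer_nonneg 1) (integrable_fejer 1)]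
  have hsub : Set.Ioo (0 : ℝ) 1 ⊆ Function.support (fejer 1) := by
    intro t ht
    have h1 : Real.cos (1 * t) < 1 := by
      rw [one_mul, ← Real.cos_zero]
      exact Real.cos_lt_cos_of_nonneg_of_le_pi le_rfl
        (by linarith [ht.2, Real.pi_gt_three]) ht.1
    have : 0 < fejer 1 t := div_pos (by linarith) (pow_pos ht.1 2)
    exact this.ne'
  exact lt_of_lt_of_le (by simp) (measure_mono hsub)

theorem integral_fejer (c : ℝ) : ∫ t, fejer c t = fejerMass * |c| := by
  rcases eq_or_ne c 0 with rfl | hc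
  · simp [fejer]
  · have h : ∀ t, fejer c t = c ^ 2 * fejer 1 (c * t) := by
      intro t
      unfold fejer
      rcases eq_or_ne t 0 with rfl | ht
      · simp
      · field_simp
    simp_rw [h]
    rw [integral_const_mul, Measure.integral_comp_mul_left, fejerMass, smul_eq_mul, abs_inv,
      ← sq_abs c]
    have : |c| ≠ 0 := abs_ne_zero.2 hc
    field_simp

/-- The kernel whose Fourier transform is the trapezoid equal to `1` on `[-a, a]` and to `0` off
`[-b, b]`. -/
def trapKernel (a b t : ℝ) : ℝ :=
  (Real.cos (a * t) - Real.cos (b * t)) / (fejerMass * (b - a) * t ^ 2)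

/-- The trapezoid equal to `1` on `[-a, a]` and to `0` off `[-b, b]`. -/
def trap (a b x : ℝ) : ℝ :=
  (|b + x| + |b - x| - |a + x| - |a - x|) / (2 * (b - a))

theorem trapKernel_eq (a b t : ℝ) :
    trapKernel a b t = (fejerMass * (b - a))⁻¹ * (fejer b t - fejer a t) := by
  unfold trapKernel fejer
  rw [div_mul_eq_div_div, ← sub_div, div_eq_inv_mul, div_eq_inv_mul, div_eq_inv_mul]
  ring

theorem integrable_trapKernel (a b : ℝ) : Integrable (trapKernel a b) := by
  have : trapKernel a b = fun t => (fejerMass * (b - a))⁻¹ * (fejer b t - fejer a t) :=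
    funext (trapKernel_eq a b)
  rw [this]
  exact ((integrable_fejer b).sub (integrable_fejer a)).const_mul _

/-- Product-to-sum formulas turn the integrand into four dilates of the Fejér kernel, and each has
an integral proportional to the modulus of its frequency. -/
theorem integral_trapKernel_mul_cos {a b : ℝ} (x : ℝ) :
    ∫ t, trapKernel a b t * Real.cos (x * t) = trap a b x := by
  have h : ∀ t, trapKernel a b t * Real.cos (x * t) = (2 * (fejerMass * (b - a)))⁻¹ *
      (fejer (b + x) t + fejer (b - x) t - fejer (a + x) t - fejer (a - x) t) := by
    intro t
    rw [trapKernel_eq]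
    unfold fejer
    simp only [add_mul, sub_mul, Real.cos_add, Real.cos_sub, mul_inv, div_eq_mul_inv]
    ring
  simp_rw [h]
  rw [integral_const_mul, integral_sub, integral_sub, integral_add]
  · simp only [integral_fejer, trap]
    have := fejerMass_pos.ne'
    rw [← mul_add, ← mul_sub, ← mul_sub, div_eq_inv_mul]
    field_simp
  all_goals first
    | exact integrable_fejer _
    | exact (integrable_fejer _).add (integrable_fejer _)
    | exact ((integrable_fejer _).add (integrable_fejer _)).sub (integrable_fejer _)

theorem integral_trapKernel_mul_sin (a b x : ℝ) :
    ∫ t, trapKernel a b t * Real.sin (x * t) = 0 := by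
  have h := integral_neg_eq_self (fun t => trapKernel a b t * Real.sin (x * t)) volume
  have h2 : ∀ t, trapKernel a b (-t) * Real.sin (x * -t)
      = -(trapKernel a b t * Real.sin (x * t)) := by
    intro t; simp [trapKernel]
  simp_rw [h2] at h
  rw [integral_neg] at h
  linarith

theorem integral_trapKernel_mul_exp (a b x : ℝ) :
    ∫ t, (trapKernel a b t : ℂ) * Complex.exp (-Complex.I * x * t) = trap a b x := by
  have hc : Integrable fun t => trapKernel a b t * Real.cos (x * t) :=
    (integrable_trapKernel a b).mul_bdd (c := 1) (by fun_prop)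
      (ae_of_all _ fun t => by simpa using Real.abs_cos_le_one _)
  have hs : Integrable fun t => trapKernel a b t * Real.sin (x * t) :=
    (integrable_trapKernel a b).mul_bdd (c := 1) (by fun_prop)
      (ae_of_all _ fun t => by simpa using Real.abs_sin_le_one _)
  have h : ∀ t : ℝ, (trapKernel a b t : ℂ) * Complex.exp (-Complex.I * x * t)
      = ((trapKernel a b t * Real.cos (x * t) : ℝ) : ℂ)
        - Complex.I * ((trapKernel a b t * Real.sin (x * t) : ℝ) : ℂ) := by
    intro t
    have : -Complex.I * x * t = (-(x * t) : ℂ) * Complex.I := by ring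
    rw [this, Complex.exp_mul_I, Complex.cos_neg, Complex.sin_neg]
    push_cast
    ring
  simp_rw [h]
  rw [integral_sub hc.ofReal (hs.ofReal.const_mul _), integral_const_mul,
    integral_complex_ofReal, integral_complex_ofReal, integral_trapKernel_mul_cos,
    integral_trapKernel_mul_sin]
  simp

theorem trap_eq_one {a b x : ℝ} (hab : a < b) (hx : 0 ≤ x) (hxa : x ≤ a) : trap a b x = 1 := by
  unfold trap
  rw [abs_of_nonneg (by linarith), abs_of_nonneg (by linarith), abs_of_nonneg (by linarith),
    abs_of_nonneg (by linarith), div_eq_one_iff_eq (by linarith)]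
  ring

theorem trap_eq_zero {a b x : ℝ} (ha : 0 ≤ a) (hab : a < b) (hx : b ≤ x) : trap a b x = 0 := by
  unfold trap
  rw [abs_of_nonneg (by linarith), abs_of_nonpos (by linarith), abs_of_nonneg (by linarith),
    abs_of_nonpos (by linarith)]
  exact div_eq_zero_iff.2 (Or.inl (by ring))

theorem abs_trap_le_one {a b : ℝ} (x : ℝ) (hab : a < b) : |trap a b x| ≤ 1 := by
  unfold trap
  rw [abs_div, abs_of_pos (show 0 < 2 * (b - a) by linarith), div_le_one (by linarith)]
  have h1 := abs_le.1 (abs_abs_sub_abs_le (b + x) (a + x))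
  have h2 := abs_le.1 (abs_abs_sub_abs_le (b - x) (a - x))
  have h3 : |b + x - (a + x)| = b - a := by rw [abs_of_pos] <;> linarith
  have h4 : |b - x - (a - x)| = b - a := by rw [abs_of_pos] <;> linarith
  rw [h3] at h1
  rw [h4] at h2
  rw [abs_le]
  constructor <;> linarith [h1.1, h1.2, h2.1, h2.2]

theorem abs_trapKernel_le_add {a b : ℝ} (ha : 0 ≤ a) (hab : a < b) (t : ℝ) :
    |trapKernel a b t| ≤ (a + b) / (2 * fejerMass) := by
  have hM := fejerMass_pos
  have hb : 0 < b := ha.trans_lt hab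
  unfold trapKernel
  rcases eq_or_ne t 0 with rfl | ht
  · simp; positivity
  have ht2 : 0 < t ^ 2 := by positivity
  have hba : 0 < b - a := sub_pos.2 hab
  rw [abs_div, abs_of_pos (by positivity : 0 < fejerMass * (b - a) * t ^ 2),
    div_le_div_iff₀ (by positivity) (by positivity), Real.cos_sub_cos, abs_mul, abs_mul]
  have h1 : |Real.sin ((a * t + b * t) / 2)| ≤ (a + b) / 2 * |t| := by
    refine Real.abs_sin_le_abs.trans (le_of_eq ?_)
    rw [show (a * t + b * t) / 2 = (a + b) / 2 * t by ring, abs_mul, abs_of_nonneg (by linarith)]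
  have h2 : |Real.sin ((a * t - b * t) / 2)| ≤ (b - a) / 2 * |t| := by
    refine Real.abs_sin_le_abs.trans (le_of_eq ?_)
    rw [show (a * t - b * t) / 2 = -((b - a) / 2) * t by ring, abs_mul, abs_neg,
      abs_of_nonneg (by linarith)]
  have h3 : |(-2 : ℝ)| = 2 := by norm_num
  have h4 := mul_le_mul h1 h2 (abs_nonneg _) (by positivity)

  have h5 : (a + b) / 2 * |t| * ((b - a) / 2 * |t|) = (a + b) * (b - a) * t ^ 2 / 4 := by
    rw [← sq_abs t]; ring
  rw [h5] at h4
  rw [h3]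
  nlinarith

/-- The cosine is 1-Lipschitz, so the factor `b - a` cancels: this decay does not see how steep the
trapezoid is. -/
theorem abs_trapKernel_le_inv {a b : ℝ} (hab : a < b) (t : ℝ) :
    |trapKernel a b t| ≤ fejerMass⁻¹ * |t|⁻¹ := by
  have hM := fejerMass_pos
  unfold trapKernel
  rcases eq_or_ne t 0 with rfl | ht
  · simp
  have hba : 0 < b - a := sub_pos.2 hab
  have ht' : 0 < |t| := abs_pos.2 ht
  rw [abs_div, ← sq_abs t, abs_of_pos (by positivity : 0 < fejerMass * (b - a) * |t| ^ 2),
    ← mul_inv, div_le_iff₀ (by positivity)]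
  have h := Real.abs_cos_sub_cos_le (a * t) (b * t)
  rw [← sub_mul, abs_mul, abs_sub_comm a b, abs_of_pos hba] at h
  refine h.trans (le_of_eq ?_)
  field_simp

theorem abs_trapKernel_le_inv_sq {a b : ℝ} (hab : a < b) (t : ℝ) :
    |trapKernel a b t| ≤ 2 * fejerMass⁻¹ * (b - a)⁻¹ * (|t| ^ 2)⁻¹ := by
  have hM := fejerMass_pos
  unfold trapKernel
  have hba : 0 < b - a := sub_pos.2 hab
  rw [abs_div, ← sq_abs t, abs_of_nonneg (by positivity : 0 ≤ fejerMass * (b - a) * |t| ^ 2),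
    div_eq_mul_inv, mul_inv, mul_inv]
  have h : |Real.cos (a * t) - Real.cos (b * t)| ≤ 2 := by
    rw [abs_le]
    constructor <;> linarith [Real.cos_le_one (a * t), Real.cos_le_one (b * t),
      Real.neg_one_le_cos (a * t), Real.neg_one_le_cos (b * t)]
  have h' : 0 ≤ fejerMass⁻¹ * (b - a)⁻¹ * (|t| ^ 2)⁻¹ := by positivity
  calc _ ≤ 2 * (fejerMass⁻¹ * (b - a)⁻¹ * (|t| ^ 2)⁻¹) := mul_le_mul_of_nonneg_right h h'
    _ = _ := by ring

/-! ### An integrable majorant -/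

/-- The function equal to `A` on `[-2, 2]` and to `B / (|t| log² |t|)` elsewhere. -/
def logMajorant (A B t : ℝ) : ℝ :=
  if |t| ≤ 2 then A else B * (|t| * Real.log |t| ^ 2)⁻¹

theorem integrableOn_inv_mul_log_sq :
    IntegrableOn (fun t : ℝ => (t * Real.log t ^ 2)⁻¹) (Set.Ioi 2) := by
  -- The integrand is the derivative of `-1 / log t`, which tends to `0`.
  refine integrableOn_Ioi_deriv_of_nonneg' (g := fun t => -(Real.log t)⁻¹) (l := -0) ?_ ?_ ?_
  · intro t ht
    have ht' : (2 : ℝ) ≤ t := ht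
    have hl : 0 < Real.log t := Real.log_pos (by linarith)
    have := ((Real.hasDerivAt_log (by linarith : t ≠ 0)).inv hl.ne').neg
    refine this.congr_deriv ?_
    rw [mul_inv, neg_div, neg_neg, div_eq_mul_inv]
  · intro t ht
    have ht' : (2 : ℝ) < t := ht
    positivity
  · exact (tendsto_inv_atTop_zero.comp Real.tendsto_log_atTop).neg

theorem integrable_logMajorant (A B : ℝ) : Integrable (logMajorant A B) := by
  have hR : IntegrableOn (logMajorant A B) (Set.Ioi 2) := by
    refine IntegrableOn.congr_fun (f := fun t : ℝ => B * (t * Real.log t ^ 2)⁻¹)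
      (Integrable.const_mul integrableOn_inv_mul_log_sq B) (fun t ht => ?_) measurableSet_Ioi
    have ht' : (2 : ℝ) < t := ht
    simp only [logMajorant]
    rw [abs_of_pos (by linarith), if_neg (not_le.2 ht')]
  have hL : IntegrableOn (logMajorant A B) (Set.Iio (-2)) := by
    have h := IntegrableOn.comp_neg_Iio (f := logMajorant A B) (c := -2) (μ := volume)
      (by rwa [neg_neg])
    refine h.congr_fun (fun t _ => ?_) measurableSet_Iio
    simp only [logMajorant, abs_neg]
  have hC : IntegrableOn (logMajorant A B) (Set.Icc (-2) 2) := by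
    refine (integrableOn_const (C := A) (by simp)).congr_fun (fun t ht => ?_) measurableSet_Icc
    simp only [logMajorant]
    rw [if_pos (abs_le.2 ht)]
  rw [← integrableOn_univ]
  have : (Set.univ : Set ℝ) = Set.Iio (-2) ∪ (Set.Icc (-2) 2 ∪ Set.Ioi 2) := by
    ext t; simp only [Set.mem_univ, Set.mem_union, Set.mem_Iio, Set.mem_Icc, Set.mem_Ioi, true_iff]
    by_contra! h
    linarith [h.2.1 h.1, h.2.2]
  rw [this]
  exact hL.union (hC.union hR)

/-- Exponentiating the hypothesis bounds `L - a` below by `L + a`, hence by `ℓ`, times `exp (-C₀ *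
exp (δ * a))`; the factor `ℓ` is absorbed because `exp (δ * a) ≥ 1`. -/
theorem exp_gap_le {C₀ ℓ δ a L d : ℝ} (hℓ : 0 < ℓ) (hδ : 0 < δ) (ha : 0 ≤ a) (haL : a < L)
    (hL : ℓ ≤ L) (hd : 0 ≤ d)
    (h : Real.log ((L + a) / (L - a)) + d ≤ C₀ * Real.exp (δ * a)) :
    Real.exp (-((C₀ + |Real.log ℓ|) * Real.exp (δ * a))) ≤ L - a := by
  have hq : 1 ≤ Real.exp (δ * a) := Real.one_le_exp (by positivity)
  have hLa : 0 < L - a := sub_pos.2 haL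
  have hpos : 0 < (L + a) / (L - a) := div_pos (by linarith) hLa
  have h1 : (L + a) / (L - a) ≤ Real.exp (C₀ * Real.exp (δ * a)) :=
    (Real.log_le_iff_le_exp hpos).1 (by linarith)
  rw [div_le_iff₀ hLa] at h1
  have h2 : Real.exp (-(|Real.log ℓ| * Real.exp (δ * a))) ≤ ℓ := by
    rw [← Real.le_log_iff_exp_le hℓ]
    have := neg_abs_le (Real.log ℓ)
    nlinarith [abs_nonneg (Real.log ℓ)]
  have h3 : Real.exp (-((C₀ + |Real.log ℓ|) * Real.exp (δ * a)))
      = Real.exp (-(|Real.log ℓ| * Real.exp (δ * a))) * (Real.exp (C₀ * Real.exp (δ * a)))⁻¹ := by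
    rw [← Real.exp_neg, ← Real.exp_add]; ring_nf
  rw [h3, ← div_eq_mul_inv, div_le_iff₀ (Real.exp_pos _)]
  linarith

theorem log_sq_le {s : ℝ} (hs : 1 ≤ s) : Real.log s ^ 2 ≤ 16 * Real.exp (Real.log s / 2) := by
  have hl := Real.log_nonneg hs
  have h1 : Real.log s / 4 ≤ Real.exp (Real.log s / 4) := by
    linarith [Real.add_one_le_exp (Real.log s / 4)]
  have h2 : Real.exp (Real.log s / 2) = Real.exp (Real.log s / 4) ^ 2 := by
    rw [← Real.exp_nat_mul]; ring_nf
  rw [h2]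
  nlinarith [pow_le_pow_left₀ (by positivity) h1 2]

/-- Two regimes. If `log |t| ≤ 2 * C * q`, the factor `q⁻²` supplies the missing `1 / log² |t|` in
the bound by `1 / |t|`. Otherwise `1 / (b - a) ≤ exp (C * q) ≤ |t| ^ (1 / 2)`, and the bound by `1 /
((b - a) * t²)` leaves `|t| ^ (-3 / 2)`. -/
theorem inv_sq_mul_trapKernel_le {C q a b t : ℝ} (hq : 1 ≤ q) (hab : a < b)
    (hgap : Real.exp (-(C * q)) ≤ b - a) (ht : 2 < |t|) :
    (q ^ 2)⁻¹ * |trapKernel a b t|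
      ≤ fejerMass⁻¹ * (4 * C ^ 2 + 32) * (|t| * Real.log |t| ^ 2)⁻¹ := by
  have hM : 0 < fejerMass⁻¹ := inv_pos.2 fejerMass_pos
  have hl : 0 < Real.log |t| := Real.log_pos (by linarith)
  have ht0 : 0 < |t| := by linarith
  have hq0 : 0 < q := by linarith
  rcases le_or_gt (Real.log |t|) (2 * C * q) with h | h
  · calc (q ^ 2)⁻¹ * |trapKernel a b t| ≤ (q ^ 2)⁻¹ * (fejerMass⁻¹ * |t|⁻¹) :=
          mul_le_mul_of_nonneg_left (abs_trapKernel_le_inv hab t) (by positivity)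
      _ ≤ ((4 * C ^ 2) * (Real.log |t| ^ 2)⁻¹) * (fejerMass⁻¹ * |t|⁻¹) := by
          refine mul_le_mul_of_nonneg_right ?_ (by positivity)
          rw [← div_eq_mul_inv, inv_eq_one_div, div_le_div_iff₀ (by positivity) (by positivity)]
          have := pow_le_pow_left₀ hl.le h 2
          linarith [mul_pow (2 * C) q 2, mul_pow 2 C 2]
      _ = fejerMass⁻¹ * (4 * C ^ 2) * (|t| * Real.log |t| ^ 2)⁻¹ := by rw [mul_inv]; ring
      _ ≤ _ := by
          refine mul_le_mul_of_nonneg_right ?_ (by positivity)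
          exact mul_le_mul_of_nonneg_left (by linarith) hM.le
  · set r := Real.exp (Real.log |t| / 2) with hr
    have hr0 : 0 < r := Real.exp_pos _
    have hr2 : r ^ 2 = |t| := by
      rw [hr, ← Real.exp_nat_mul]
      push_cast
      rw [mul_div_cancel₀ _ (two_ne_zero), Real.exp_log ht0]
    have hba : (b - a)⁻¹ ≤ r := by
      rw [inv_le_comm₀ (by linarith) hr0, hr, ← Real.exp_neg]
      exact (Real.exp_le_exp.2 (by linarith)).trans hgap
    have hlog : Real.log |t| ^ 2 ≤ 16 * r := log_sq_le (by linarith)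
    calc (q ^ 2)⁻¹ * |trapKernel a b t|
        ≤ 1 * (2 * fejerMass⁻¹ * (b - a)⁻¹ * (|t| ^ 2)⁻¹) :=
          mul_le_mul (inv_le_one_of_one_le₀ (one_le_pow₀ hq)) (abs_trapKernel_le_inv_sq hab t)
            (abs_nonneg _) zero_le_one
      _ ≤ 2 * fejerMass⁻¹ * r * (|t| ^ 2)⁻¹ := by rw [one_mul]; gcongr
      _ ≤ fejerMass⁻¹ * 32 * (|t| * Real.log |t| ^ 2)⁻¹ := by
          have : r * (|t| ^ 2)⁻¹ ≤ 16 * (|t| * Real.log |t| ^ 2)⁻¹ := by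
            rw [← div_eq_mul_inv, ← div_eq_mul_inv,
              div_le_div_iff₀ (by positivity) (by positivity)]
            calc r * (|t| * Real.log |t| ^ 2) ≤ r * (|t| * (16 * r)) := by gcongr
              _ = 16 * |t| * r ^ 2 := by ring
              _ = 16 * |t| ^ 2 := by rw [hr2]; ring
          nlinarith
      _ ≤ _ := by
          refine mul_le_mul_of_nonneg_right ?_ (by positivity)
          exact mul_le_mul_of_nonneg_left (by nlinarith [sq_nonneg C]) hM.le

/-- Under (NC), the trapezoidal kernels adapted to the frequency, damped by `exp (-v lam_n)`, have
a common integrable majorant. -/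
theorem NC.exists_trapKernel_le {lam : ℕ → ℝ} (hlam : IsFrequency lam) (hNC : NC lam) {v : ℝ}
    (hv : 0 < v) : ∃ A B C : ℝ, ∀ n : ℕ, ∃ m : ℕ, n < m ∧ ∃ b : ℝ,
      lam n < b ∧ b ≤ lam m ∧ Real.exp (-v * lam n) * ((m : ℝ) - n) ≤ C ∧
      ∀ t : ℝ, Real.exp (-v * lam n) * |trapKernel (lam n) b t| ≤ logMajorant A B t := by
  -- Half of `v`: the damping `exp (-v * lam n)` is then exactly `q⁻²`, where `q` is the exponential
  -- in (NC).
  obtain ⟨C₀, hC₀, h⟩ := hNC (v / 2) (half_pos hv)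
  have hM := fejerMass_pos
  -- The reference value is `lam 1` since `lam 0` may vanish; it bounds `lam m` below because `m ≥
  -- 1`.
  have hℓ : 0 < lam 1 := (hlam.nonneg 0).trans_lt (hlam.strictMono zero_lt_one)
  set C₁ := C₀ + |Real.log (lam 1)| with hC₁
  have hC₁0 : 0 ≤ C₁ := by positivity
  refine ⟨(2 / v + 1) / (2 * fejerMass), fejerMass⁻¹ * (4 * C₁ ^ 2 + 32), C₀, fun n => ?_⟩
  obtain ⟨m, hnm, hm⟩ := h n
  have ha := hlam.nonneg n
  have haL : lam n < lam m := hlam.strictMono hnm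
  have hL : lam 1 ≤ lam m := hlam.strictMono.monotone (by omega)
  have hd : (0 : ℝ) ≤ (m : ℝ) - n := sub_nonneg.2 (by exact_mod_cast hnm.le)
  have hgap := exp_gap_le hℓ (half_pos hv) ha haL hL hd hm
  set q := Real.exp (v / 2 * lam n) with hq
  have hq1 : 1 ≤ q := Real.one_le_exp (by positivity)
  have hq2 : Real.exp (-v * lam n) = (q ^ 2)⁻¹ := by
    rw [hq, ← Real.exp_nat_mul, ← Real.exp_neg]; push_cast; ring_nf
  -- Capping `b` at `lam n + 1` keeps the kernel of size `O(lam n + 1)` near the origin even if `lam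
  -- m` is far away.
  have hab : lam n < min (lam m) (lam n + 1) := lt_min haL (by linarith)
  refine ⟨m, hnm, min (lam m) (lam n + 1), hab, min_le_left _ _, ?_, fun t => ?_⟩
  · have hlog : 0 ≤ Real.log ((lam m + lam n) / (lam m - lam n)) :=
      Real.log_nonneg ((one_le_div (by linarith)).2 (by linarith))
    rw [hq2, inv_mul_le_iff₀ (by positivity)]
    nlinarith
  · unfold logMajorant
    split_ifs with ht
    · have h1 : Real.exp (-v * lam n) * lam n ≤ 1 / v := by
        rw [neg_mul, Real.exp_neg, inv_mul_le_iff₀ (Real.exp_pos _), mul_one_div,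
          le_div_iff₀ hv]
        linarith [Real.add_one_le_exp (v * lam n)]
      have h2 : Real.exp (-v * lam n) ≤ 1 := Real.exp_le_one_iff.2 (by nlinarith)
      have h3 := Real.exp_pos (-v * lam n)
      calc _ ≤ Real.exp (-v * lam n)
            * ((lam n + min (lam m) (lam n + 1)) / (2 * fejerMass)) :=
            mul_le_mul_of_nonneg_left (abs_trapKernel_le_add ha hab t) h3.le
        _ ≤ Real.exp (-v * lam n) * ((lam n + (lam n + 1)) / (2 * fejerMass)) := by
            gcongr; exact min_le_right _ _
        _ = (2 * (Real.exp (-v * lam n) * lam n) + Real.exp (-v * lam n)) / (2 * fejerMass) := by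
            ring
        _ ≤ _ := by
            gcongr
            calc _ ≤ 2 * (1 / v) := by linarith
              _ = 2 / v := by ring
    · rw [hq2]
      refine inv_sq_mul_trapKernel_le hq1 hab ?_ (not_le.1 ht)
      rw [le_sub_iff_add_le, le_min_iff]
      refine ⟨by linarith, ?_⟩
      have : Real.exp (-(C₁ * q)) ≤ 1 := Real.exp_le_one_iff.2 (by
        have := mul_nonneg hC₁0 (zero_le_one.trans hq1); linarith)
      linarith

/-! ### Averages in `L_p` -/

/-- This is Hölder's inequality between the `L_1` and `L_p` norms for the measure of density `k`. -/
theorem lintegral_mul_rpow_le {S : Type*} [MeasurableSpace S] (ν : Measure S)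
    {F k : S → ℝ≥0∞} (hF : Measurable F) (hk : Measurable k) {p : ℝ} (hp : 1 ≤ p) :
    (∫⁻ s, F s * k s ∂ν) ^ p ≤ (∫⁻ s, k s ∂ν) ^ (p - 1) * ∫⁻ s, F s ^ p * k s ∂ν := by
  have hp0 : 0 < p := by linarith
  have h := eLpNorm_le_eLpNorm_mul_rpow_measure_univ (μ := ν.withDensity k) (f := F) (p := 1)
    (q := ENNReal.ofReal p) (by simpa using hp) hF.aestronglyMeasurable
  rw [eLpNorm_one_eq_lintegral_enorm, eLpNorm_eq_lintegral_rpow_enorm_toReal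
    (by simpa using hp0) ENNReal.ofReal_ne_top, ENNReal.toReal_ofReal hp0.le,
    withDensity_apply _ MeasurableSet.univ, Measure.restrict_univ,
    lintegral_withDensity_eq_lintegral_mul₀ hk.aemeasurable (by fun_prop),
    lintegral_withDensity_eq_lintegral_mul₀ hk.aemeasurable (by fun_prop)] at h
  have h' := ENNReal.rpow_le_rpow h hp0.le
  rw [ENNReal.mul_rpow_of_nonneg _ _ hp0.le, ← ENNReal.rpow_mul, ← ENNReal.rpow_mul,
    one_div_mul_cancel hp0.ne', ENNReal.rpow_one] at h'
  have e : (1 / ENNReal.toReal 1 - 1 / p) * p = p - 1 := by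
    simp only [ENNReal.toReal_one]; field_simp
  rw [e, mul_comm] at h'
  simpa [mul_comm] using h'

theorem lintegral_lintegral_mul_rpow_le {X S : Type*} [MeasurableSpace X] [MeasurableSpace S]
    (μ : Measure X) (ν : Measure S) [SFinite μ] [SFinite ν] {H k : X → S → ℝ≥0∞}
    (hH : Measurable (Function.uncurry H)) (hk : Measurable (Function.uncurry k)) {A : ℝ≥0∞}
    (hA : ∀ x, ∫⁻ s, k x s ∂ν ≤ A) {p : ℝ} (hp : 1 ≤ p) :
    ∫⁻ x, (∫⁻ s, H x s * k x s ∂ν) ^ p ∂μ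
      ≤ A ^ (p - 1) * ∫⁻ s, ∫⁻ x, H x s ^ p * k x s ∂μ ∂ν := by
  have hm : Measurable (Function.uncurry fun x s => H x s ^ p * k x s) := (hH.pow_const p).mul hk
  have hm' : Measurable fun x => ∫⁻ s, H x s ^ p * k x s ∂ν := hm.lintegral_prod_right'
  rw [← lintegral_lintegral_swap hm.aemeasurable, ← lintegral_const_mul _ hm']
  refine lintegral_mono fun x => ?_
  refine (lintegral_mul_rpow_le ν (hH.comp measurable_prodMk_left)
    (hk.comp measurable_prodMk_left) hp).trans ?_
  exact mul_le_mul_left (ENNReal.rpow_le_rpow (hA x) (by linarith)) _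

/-- Averaging against a doubly stochastic kernel is a contraction of `L_p`. -/
theorem eLpNorm_lintegral_kernel_le {X : Type*} [MeasurableSpace X] (μ : Measure X) [SFinite μ]
    {k : X → X → ℝ≥0∞} (hk : Measurable (Function.uncurry k)) (h₁ : ∀ x, ∫⁻ y, k x y ∂μ = 1)
    (h₂ : ∀ y, ∫⁻ x, k x y ∂μ = 1) {F : X → ℝ≥0∞} (hF : AEMeasurable F μ) {p : ℝ≥0∞}
    (hp : 1 ≤ p) :
    eLpNorm (fun x => ∫⁻ y, F y * k x y ∂μ) p μ ≤ eLpNorm F p μ := by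
  have hF' : ∀ x, ∫⁻ y, F y * k x y ∂μ = ∫⁻ y, hF.mk F y * k x y ∂μ := fun x =>
    lintegral_congr_ae (hF.ae_eq_mk.mono fun y hy => by simp only [hy])
  have hk₁ : ∀ x, Measurable (k x) := fun x => hk.comp measurable_prodMk_left
  have hk₂ : ∀ y, Measurable fun x => k x y := fun y => hk.comp measurable_prodMk_right
  simp_rw [hF']
  rw [eLpNorm_congr_ae hF.ae_eq_mk]
  set F' := hF.mk F
  have hm : Measurable F' := hF.measurable_mk
  rcases eq_or_ne p ⊤ with rfl | hpt
  · rw [eLpNorm_exponent_top, eLpNorm_exponent_top]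
    refine eLpNormEssSup_le_of_ae_enorm_bound (ae_of_all _ fun x => ?_)
    rw [enorm_eq_self]
    calc ∫⁻ y, F' y * k x y ∂μ ≤ ∫⁻ y, eLpNormEssSup F' μ * k x y ∂μ := by
          refine lintegral_mono_ae ?_
          filter_upwards [enorm_ae_le_eLpNormEssSup F' μ] with y hy
          rw [enorm_eq_self] at hy
          exact mul_le_mul_left hy _
      _ = eLpNormEssSup F' μ := by
          rw [lintegral_const_mul _ (hk₁ x), h₁, mul_one]
  · have hp0 : p ≠ 0 := (zero_lt_one.trans_le hp).ne'
    have hpr : 1 ≤ p.toReal := by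
      simpa using ENNReal.toReal_mono hpt hp
    rw [eLpNorm_eq_lintegral_rpow_enorm_toReal hp0 hpt,
      eLpNorm_eq_lintegral_rpow_enorm_toReal hp0 hpt]
    refine ENNReal.rpow_le_rpow ?_ (by positivity)
    simp only [enorm_eq_self]
    refine (lintegral_lintegral_mul_rpow_le μ μ (H := fun _ y => F' y) (k := k) (A := 1)
      (hm.comp measurable_snd) hk (fun x => (h₁ x).le) hpr).trans ?_
    rw [ENNReal.one_rpow, one_mul]
    refine le_of_eq (lintegral_congr fun y => ?_)
    rw [lintegral_const_mul _ (hk₂ y), h₂, mul_one]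

section Group

variable {G : Type*} [CommGroup G] [TopologicalSpace G]

/-! ### Positive definite trigonometric polynomials -/

/-- Characters as complex valued functions. -/
def characterHom : PontryaginDual G →* (G → ℂ) where
  toFun χ ω := ((χ ω : Circle) : ℂ)
  map_one' := by ext ω; simp
  map_mul' χ ψ := by ext ω; exact Circle.coe_mul (χ ω) (ψ ω)

theorem characterHom_apply (χ : PontryaginDual G) (ω : G) :
    characterHom χ ω = ((χ ω : Circle) : ℂ) := rfl

theorem norm_characterHom (χ : PontryaginDual G) (ω : G) : ‖characterHom χ ω‖ = 1 := by
  rw [characterHom_apply, Circle.norm_coe]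

theorem characterHom_mul (χ : PontryaginDual G) (ω y : G) :
    characterHom χ (ω * y) = characterHom χ ω * characterHom χ y := by
  simp [characterHom_apply]

theorem characterHom_inv (χ : PontryaginDual G) (ω : G) :
    characterHom χ ω⁻¹ = (starRingEnd ℂ) (characterHom χ ω) := by
  rw [characterHom_apply, characterHom_apply, map_inv, Circle.coe_inv_eq_conj]

theorem characterHom_inv' (χ : PontryaginDual G) (ω : G) :
    characterHom χ⁻¹ ω = (starRingEnd ℂ) (characterHom χ ω) := by
  rw [← characterHom_inv, characterHom_apply, characterHom_apply, map_inv]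
  rfl

theorem continuous_characterHom (χ : PontryaginDual G) : Continuous (characterHom χ) :=
  continuous_subtype_val.comp (map_continuous χ)

/-- Trigonometric polynomials whose coefficients are natural numbers. -/
def posTrig (G : Type*) [CommGroup G] [TopologicalSpace G] : Subsemiring (G → ℂ) :=
  (MonoidHom.mrange (characterHom (G := G))).subsemiringClosure

theorem characterHom_mem_posTrig (χ : PontryaginDual G) : characterHom χ ∈ posTrig G := by
  rw [posTrig, Submonoid.subsemiringClosure_mem]
  exact AddSubmonoid.subset_closure ⟨χ, rfl⟩

/-- Characters are stable under multiplication, so the semiring they generate is already their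
additive closure and products need no case. -/
theorem posTrig_induction {motive : (G → ℂ) → Prop}
    (char : ∀ χ : PontryaginDual G, motive (characterHom χ)) (zero : motive 0)
    (add : ∀ P ∈ posTrig G, ∀ Q ∈ posTrig G, motive P → motive Q → motive (P + Q))
    {P : G → ℂ} (hP : P ∈ posTrig G) : motive P := by
  rw [posTrig, Submonoid.subsemiringClosure_mem] at hP
  refine AddSubmonoid.closure_induction (motive := fun x _ => motive x) ?_ zero ?_ hP
  · rintro _ ⟨χ, rfl⟩
    exact char χ
  · intro x y hx hy
    rw [← Submonoid.subsemiringClosure_mem] at hx hy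
    exact add x hx y hy

theorem continuous_of_mem_posTrig {P : G → ℂ} (hP : P ∈ posTrig G) : Continuous P :=
  posTrig_induction (motive := Continuous) continuous_characterHom continuous_zero
    (fun _ _ _ _ h h' => h.add h') hP

variable [MeasurableSpace G] [BorelSpace G]

/-- Continuity is not enough: without second countability the Borel σ-algebra of `G × G` may exceed
the product σ-algebra. A character splits the two variables. -/
theorem measurable_of_mem_posTrig {P : G → ℂ} (hP : P ∈ posTrig G) :
    Measurable fun z : G × G => P (z.1 * z.2⁻¹) := by
  refine posTrig_induction (motive := fun P => Measurable fun z : G × G => P (z.1 * z.2⁻¹))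
    (fun χ => ?_) measurable_const (fun _ _ _ _ h h' => h.add h') hP
  have hm := (continuous_characterHom χ).measurable
  simp only [characterHom_mul, characterHom_inv]
  exact (hm.comp measurable_fst).mul
    (Complex.continuous_conj.measurable.comp (hm.comp measurable_snd))

variable [IsTopologicalGroup G] [CompactSpace G] (μ : Measure G) [μ.IsHaarMeasure]
  [IsProbabilityMeasure μ]

theorem integrable_of_continuous {f : G → ℂ} (hf : Continuous f) : Integrable f μ :=
  hf.integrable_of_hasCompactSupport (HasCompactSupport.of_compactSpace f)

open scoped Classical in
theorem integral_characterHom (χ : PontryaginDual G) :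
    ∫ ω, characterHom χ ω ∂μ = if χ = 1 then 1 else 0 := by
  split_ifs with h
  · simp [h]
  · obtain ⟨a, ha⟩ : ∃ a, characterHom χ a ≠ 1 := by
      by_contra! hc
      exact h (PontryaginDual.ext fun a => Circle.ext (by
        rw [← characterHom_apply, hc]; simp))
    have h1 := integral_mul_left_eq_self (μ := μ) (characterHom χ) a
    simp_rw [characterHom_mul] at h1
    rw [integral_const_mul] at h1
    have h2 : (characterHom χ a - 1) * ∫ ω, characterHom χ ω ∂μ = 0 := by
      rw [sub_mul, one_mul, h1, sub_self]
    exact (mul_eq_zero.1 h2).resolve_left (sub_ne_zero.2 ha)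

/-- The integral counts the occurrences of the trivial character. -/
theorem re_integral_nonneg_of_mem_posTrig {P : G → ℂ} (hP : P ∈ posTrig G) :
    0 ≤ (∫ ω, P ω ∂μ).re := by
  refine posTrig_induction (motive := fun P => 0 ≤ (∫ ω, P ω ∂μ).re) (fun χ => ?_) (by simp)
    (fun P hP Q hQ h h' => ?_) hP
  · rw [integral_characterHom]; split_ifs <;> simp
  · simp only [Pi.add_apply]
    rw [integral_add (integrable_of_continuous μ (continuous_of_mem_posTrig hP))
      (integrable_of_continuous μ (continuous_of_mem_posTrig hQ)), Complex.add_re]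
    exact add_nonneg h h'

theorem integral_mul_inv_left_of_mem_posTrig {P : G → ℂ} (hP : P ∈ posTrig G) (ω : G) :
    ∫ y, P (ω * y⁻¹) ∂μ = ∫ y, P y ∂μ := by
  refine posTrig_induction (motive := fun P => ∫ y, P (ω * y⁻¹) ∂μ = ∫ y, P y ∂μ) (fun χ => ?_)
    (by simp) (fun P hP Q hQ h h' => ?_) hP
  · simp_rw [characterHom_mul, characterHom_inv, ← characterHom_inv']
    rw [integral_const_mul, integral_characterHom, integral_characterHom]
    by_cases hχ : χ = 1 <;> simp [hχ]
  · have hc : Continuous fun y : G => ω * y⁻¹ := by fun_prop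
    simp only [Pi.add_apply]
    rw [integral_add, integral_add, h, h']
    · exact integrable_of_continuous μ (continuous_of_mem_posTrig hP)
    · exact integrable_of_continuous μ (continuous_of_mem_posTrig hQ)
    · exact integrable_of_continuous μ ((continuous_of_mem_posTrig hP).comp hc)
    · exact integrable_of_continuous μ ((continuous_of_mem_posTrig hQ).comp hc)

end Group

section Group

variable {G : Type*} [CommGroup G] [TopologicalSpace G]

/-! ### Fejér kernels attached to finitely many characters -/

/-- The unnormalized Fejér kernel `|∑_{l < M} χ ^ l| ^ 2`. -/
def fejerSq (M : ℕ) (χ : PontryaginDual G) (ω : G) : ℝ :=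
  ‖∑ l ∈ Finset.range M, characterHom χ ω ^ l‖ ^ 2

theorem fejerSq_nonneg (M : ℕ) (χ : PontryaginDual G) (ω : G) : 0 ≤ fejerSq M χ ω :=
  sq_nonneg _

theorem coe_fejerSq (M : ℕ) (χ : PontryaginDual G) :
    (fun ω => (fejerSq M χ ω : ℂ))
      = ∑ l ∈ Finset.range M, ∑ k ∈ Finset.range M, characterHom (χ ^ l * (χ ^ k)⁻¹) := by
  ext ω
  rw [fejerSq, Complex.ofReal_pow, ← Complex.mul_conj', map_sum, Finset.sum_mul_sum,
    Finset.sum_apply]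
  refine Finset.sum_congr rfl fun l _ => ?_
  rw [Finset.sum_apply]
  refine Finset.sum_congr rfl fun k _ => ?_
  rw [map_mul, Pi.mul_apply, characterHom_inv', map_pow characterHom, map_pow characterHom,
    Pi.pow_apply, Pi.pow_apply, map_pow]

theorem coe_fejerSq_mem_posTrig (M : ℕ) (χ : PontryaginDual G) :
    (fun ω => (fejerSq M χ ω : ℂ)) ∈ posTrig G := by
  rw [coe_fejerSq]
  exact sum_mem fun l _ => sum_mem fun k _ => characterHom_mem_posTrig _

theorem norm_one_sub_sq_mul_fejerSq_le (M : ℕ) (χ : PontryaginDual G) (ω : G) :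
    ‖1 - characterHom χ ω‖ ^ 2 * fejerSq M χ ω ≤ 4 := by
  rw [fejerSq, ← mul_pow, ← norm_mul, ← neg_sub, neg_mul, norm_neg, mul_geom_sum]
  have h : ‖characterHom χ ω ^ M - 1‖ ≤ 2 := by
    refine (norm_sub_le _ _).trans ?_
    rw [norm_pow, norm_characterHom, norm_one, one_pow]
    norm_num
  nlinarith [norm_nonneg (characterHom χ ω ^ M - 1)]

theorem continuous_of_coe_mem_posTrig {P : G → ℝ} (hP : (fun ω => (P ω : ℂ)) ∈ posTrig G) :
    Continuous P := by
  have := Complex.continuous_re.comp (continuous_of_mem_posTrig hP)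
  simpa [Function.comp_def] using this

theorem coe_prod_fejerSq_mem_posTrig (M : ℕ) (h : ℕ → PontryaginDual G) (s : Finset ℕ) :
    (fun ω => ((∏ j ∈ s, fejerSq M (h j) ω : ℝ) : ℂ)) ∈ posTrig G := by
  have : (fun ω => ((∏ j ∈ s, fejerSq M (h j) ω : ℝ) : ℂ))
      = ∏ j ∈ s, fun ω => (fejerSq M (h j) ω : ℂ) := by
    ext ω; simp
  rw [this]
  exact prod_mem fun j _ => coe_fejerSq_mem_posTrig M (h j)

variable [MeasurableSpace G] [BorelSpace G] [IsTopologicalGroup G] [CompactSpace G]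
  (μ : Measure G) [μ.IsHaarMeasure] [IsProbabilityMeasure μ]

theorem integrable_of_continuous_real {f : G → ℝ} (hf : Continuous f) : Integrable f μ :=
  hf.integrable_of_hasCompactSupport (HasCompactSupport.of_compactSpace f)

/-- Expanding the Fejér kernel gives `M²` terms whose integrals against `Q` all have nonnegative
real part; the `M` diagonal ones alone give the bound. No independence between the characters is
required. -/
theorem mul_integral_le_integral_fejerSq_mul (M : ℕ) (χ : PontryaginDual G) {Q : G → ℝ}
    (hQ : (fun ω => (Q ω : ℂ)) ∈ posTrig G) :
    M * ∫ ω, Q ω ∂μ ≤ ∫ ω, fejerSq M χ ω * Q ω ∂μ := by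
  set q : G → ℂ := fun ω => (Q ω : ℂ) with hq
  have hre : ∀ g : G → ℝ, ∫ ω, g ω ∂μ = (∫ ω, (g ω : ℂ) ∂μ).re := fun g => by
    rw [integral_complex_ofReal, Complex.ofReal_re]
  have hmem : ∀ l k, characterHom (χ ^ l * (χ ^ k)⁻¹) * q ∈ posTrig G := fun l k =>
    mul_mem (characterHom_mem_posTrig _) hQ
  have hint : ∀ l k, Integrable (characterHom (χ ^ l * (χ ^ k)⁻¹) * q) μ := fun l k =>
    integrable_of_continuous μ (continuous_of_mem_posTrig (hmem l k))
  have hexp : ∀ ω, ((fejerSq M χ ω * Q ω : ℝ) : ℂ)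
      = ∑ l ∈ Finset.range M, ∑ k ∈ Finset.range M,
        (characterHom (χ ^ l * (χ ^ k)⁻¹) * q) ω := by
    intro ω
    rw [Complex.ofReal_mul, show (fejerSq M χ ω : ℂ) = _ from congrFun (coe_fejerSq M χ) ω]
    simp only [Finset.sum_apply, Finset.sum_mul, Pi.mul_apply, hq]
  rw [hre fun ω => fejerSq M χ ω * Q ω]
  simp_rw [hexp]
  rw [integral_finsetSum _ fun l _ => integrable_finsetSum _ fun k _ => hint l k,
    Complex.re_sum]
  calc M * ∫ ω, Q ω ∂μ = ∑ l ∈ Finset.range M, ∫ ω, Q ω ∂μ := by simp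
    _ ≤ _ := by
      refine Finset.sum_le_sum fun l hl => ?_
      rw [integral_finsetSum _ fun k _ => hint l k, Complex.re_sum]
      refine le_trans (le_of_eq ?_) (Finset.single_le_sum
        (fun k _ => re_integral_nonneg_of_mem_posTrig μ (hmem l k)) hl)
      rw [mul_inv_cancel, map_one, one_mul, hre]

theorem integral_prod_fejerSq_pos {M : ℕ} (hM : 0 < M) (h : ℕ → PontryaginDual G)
    (s : Finset ℕ) : 0 < ∫ ω, ∏ j ∈ s, fejerSq M (h j) ω ∂μ := by
  induction s using Finset.induction_on with
  | empty => simp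
  | insert j s hj ih =>
    simp_rw [Finset.prod_insert hj]
    refine lt_of_lt_of_le ?_ (mul_integral_le_integral_fejerSq_mul μ M (h j)
      (coe_prod_fejerSq_mem_posTrig M h s))
    positivity

/-- The product concentrates where `h j` is near `1`: against `‖1 - h j‖²` the factor of index `j`
is at most `4` by the geometric sum, while alone it multiplies the integral of the other factors by
at least `M`. -/
theorem mul_integral_norm_one_sub_sq_mul_le (M : ℕ) (h : ℕ → PontryaginDual G) {s : Finset ℕ}
    {j : ℕ} (hj : j ∈ s) :
    M * ∫ ω, ‖1 - characterHom (h j) ω‖ ^ 2 * ∏ i ∈ s, fejerSq M (h i) ω ∂μ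
      ≤ 4 * ∫ ω, ∏ i ∈ s, fejerSq M (h i) ω ∂μ := by
  set Q : G → ℝ := fun ω => ∏ i ∈ s.erase j, fejerSq M (h i) ω with hQ
  have hQm := coe_prod_fejerSq_mem_posTrig M h (s.erase j)
  have hQc : Continuous Q := continuous_of_coe_mem_posTrig hQm
  have hPc := continuous_of_coe_mem_posTrig (coe_prod_fejerSq_mem_posTrig M h s)
  have hsplit : ∀ ω, ∏ i ∈ s, fejerSq M (h i) ω = fejerSq M (h j) ω * Q ω := fun ω =>
    (Finset.mul_prod_erase s _ hj).symm
  have h1 : ∫ ω, ‖1 - characterHom (h j) ω‖ ^ 2 * ∏ i ∈ s, fejerSq M (h i) ω ∂μ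
      ≤ ∫ ω, 4 * Q ω ∂μ := by
    refine integral_mono (integrable_of_continuous_real μ ?_)
      (integrable_of_continuous_real μ (by fun_prop)) fun ω => ?_
    · have := continuous_characterHom (h j)
      fun_prop
    · simp only [hsplit]
      rw [← mul_assoc]
      exact mul_le_mul_of_nonneg_right (norm_one_sub_sq_mul_fejerSq_le M (h j) ω)
        (Finset.prod_nonneg fun i _ => fejerSq_nonneg _ _ _)
  have h2 := mul_integral_le_integral_fejerSq_mul μ M (h j) hQm
  rw [integral_const_mul] at h1
  simp_rw [hsplit] at h1 ⊢
  calc _ ≤ M * (4 * ∫ ω, Q ω ∂μ) := mul_le_mul_of_nonneg_left h1 (Nat.cast_nonneg M)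
    _ = 4 * (M * ∫ ω, Q ω ∂μ) := by ring
    _ ≤ _ := by linarith

theorem fourierCoefficient_eq (f : G → ℂ) (χ : PontryaginDual G) :
    fourierCoefficient μ f χ = ∫ ω, f ω * (starRingEnd ℂ) (characterHom χ ω) ∂μ := rfl

/-- Nonnegative trigonometric polynomials form an approximate identity along any sequence of
characters. -/
theorem exists_posTrig_fourierCoefficient_sub_le (h : ℕ → PontryaginDual G) (N : ℕ) {ε : ℝ}
    (hε : 0 < ε) : ∃ P : G → ℝ, (fun ω => (P ω : ℂ)) ∈ posTrig G ∧ (∀ ω, 0 ≤ P ω) ∧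
      0 < ∫ ω, P ω ∂μ ∧ ∀ j < N,
        ‖fourierCoefficient μ (fun ω => (P ω : ℂ)) (h j) - ((∫ ω, P ω ∂μ : ℝ) : ℂ)‖
          ≤ ε * ∫ ω, P ω ∂μ := by
  obtain ⟨M, hM⟩ := exists_nat_gt (4 / ε ^ 2)
  have hM0 : (0 : ℝ) < M := lt_trans (by positivity) hM
  set P : G → ℝ := fun ω => ∏ i ∈ Finset.range N, fejerSq M (h i) ω with hPdef
  have hPm := coe_prod_fejerSq_mem_posTrig M h (Finset.range N)
  have hPc : Continuous P := continuous_of_coe_mem_posTrig hPm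
  have hP0 : ∀ ω, 0 ≤ P ω := fun ω => Finset.prod_nonneg fun i _ => fejerSq_nonneg _ _ _
  have hZ := integral_prod_fejerSq_pos μ (Nat.cast_pos.1 hM0) h (Finset.range N)
  refine ⟨P, hPm, hP0, hZ, fun j hj => ?_⟩
  have hχ := continuous_characterHom (h j)
  have hconc := mul_integral_norm_one_sub_sq_mul_le μ M h (Finset.mem_range.2 hj)
  change M * ∫ ω, ‖1 - characterHom (h j) ω‖ ^ 2 * P ω ∂μ ≤ 4 * ∫ ω, P ω ∂μ at hconc
  have hconc' : ∫ ω, ‖1 - characterHom (h j) ω‖ ^ 2 * P ω ∂μ ≤ ε ^ 2 * ∫ ω, P ω ∂μ := by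
    rw [div_lt_iff₀ (by positivity)] at hM
    refine le_of_mul_le_mul_left ?_ hM0
    calc _ ≤ 4 * ∫ ω, P ω ∂μ := hconc
      _ ≤ (M * ε ^ 2) * ∫ ω, P ω ∂μ := mul_le_mul_of_nonneg_right hM.le hZ.le
      _ = _ := by ring
  have hsub : fourierCoefficient μ (fun ω => (P ω : ℂ)) (h j) - ((∫ ω, P ω ∂μ : ℝ) : ℂ)
      = ∫ ω, (P ω : ℂ) * ((starRingEnd ℂ) (characterHom (h j) ω) - 1) ∂μ := by
    have hc : Continuous fun ω => (P ω : ℂ) * (starRingEnd ℂ) (characterHom (h j) ω) := by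
      fun_prop
    rw [← integral_complex_ofReal, fourierCoefficient_eq,
      ← integral_sub (integrable_of_continuous μ hc) (integrable_of_continuous μ (by fun_prop))]
    simp_rw [mul_sub, mul_one]
  rw [hsub]
  calc _ ≤ ∫ ω, ‖(P ω : ℂ) * ((starRingEnd ℂ) (characterHom (h j) ω) - 1)‖ ∂μ :=
        norm_integral_le_integral_norm _
    -- The inequality `x ≤ ε / 2 + x² / (2 * ε)` replaces Cauchy–Schwarz; each half contributes `ε /
    -- 2`.
    _ ≤ ∫ ω, (ε / 2 * P ω + (2 * ε)⁻¹ * (‖1 - characterHom (h j) ω‖ ^ 2 * P ω)) ∂μ := by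
        refine integral_mono (integrable_of_continuous_real μ (by fun_prop))
          (integrable_of_continuous_real μ (by fun_prop)) fun ω => ?_
        have e : ‖(starRingEnd ℂ) (characterHom (h j) ω) - 1‖ = ‖1 - characterHom (h j) ω‖ := by
          rw [← Complex.norm_conj, map_sub, Complex.conj_conj, map_one, norm_sub_rev]
        simp only [norm_mul, Complex.norm_real, Real.norm_of_nonneg (hP0 ω), e]
        set x := ‖1 - characterHom (h j) ω‖
        have hx : x ≤ ε / 2 + (2 * ε)⁻¹ * x ^ 2 := by
          have : ε / 2 + (2 * ε)⁻¹ * x ^ 2 - x = (2 * ε)⁻¹ * (x - ε) ^ 2 := by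
            field_simp; ring
          have : 0 ≤ (2 * ε)⁻¹ * (x - ε) ^ 2 := by positivity
          linarith
        calc P ω * x ≤ P ω * (ε / 2 + (2 * ε)⁻¹ * x ^ 2) :=
              mul_le_mul_of_nonneg_left hx (hP0 ω)
          _ = _ := by ring
    _ = ε / 2 * ∫ ω, P ω ∂μ + (2 * ε)⁻¹ * ∫ ω, ‖1 - characterHom (h j) ω‖ ^ 2 * P ω ∂μ := by
        rw [integral_add (integrable_of_continuous_real μ (by fun_prop))
          (integrable_of_continuous_real μ (by fun_prop)), integral_const_mul,
          integral_const_mul]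
    _ ≤ ε / 2 * ∫ ω, P ω ∂μ + (2 * ε)⁻¹ * (ε ^ 2 * ∫ ω, P ω ∂μ) := by gcongr
    _ = _ := by field_simp; ring

/-! ### Approximation by Dirichlet polynomials -/

open scoped Classical in
theorem fourierCoefficient_characterHom (χ ψ : PontryaginDual G) :
    fourierCoefficient μ (characterHom χ) ψ = if χ = ψ then 1 else 0 := by
  have h := integral_characterHom μ (χ * ψ⁻¹)
  simp only [map_mul, Pi.mul_apply, characterHom_inv', mul_inv_eq_one] at h
  exact h

theorem fourierCoefficient_add {f g : G → ℂ} (hf : Integrable f μ) (hg : Integrable g μ)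
    (χ : PontryaginDual G) :
    fourierCoefficient μ (f + g) χ = fourierCoefficient μ f χ + fourierCoefficient μ g χ := by
  have hc : Continuous fun ω => (starRingEnd ℂ) (characterHom χ ω) :=
    Complex.continuous_conj.comp (continuous_characterHom χ)
  have hb : ∀ ω, ‖(starRingEnd ℂ) (characterHom χ ω)‖ ≤ 1 := fun ω => by
    rw [Complex.norm_conj, norm_characterHom]
  simp only [fourierCoefficient, Pi.add_apply, add_mul]
  exact integral_add (hf.mul_bdd hc.measurable.aestronglyMeasurable (ae_of_all _ hb))
    (hg.mul_bdd hc.measurable.aestronglyMeasurable (ae_of_all _ hb))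

theorem norm_fourierCoefficient_le (f : G → ℂ) (χ : PontryaginDual G) :
    ‖fourierCoefficient μ f χ‖ ≤ ∫ ω, ‖f ω‖ ∂μ := by
  refine (norm_integral_le_integral_norm _).trans (le_of_eq ?_)
  refine integral_congr_ae (ae_of_all _ fun ω => ?_)
  simp [Circle.norm_coe]

variable {lam : ℕ → ℝ} {β : Multiplicative ℝ →ₜ* G}

theorem IsDirichletGroup.characterHom_apply_flow (hG : IsDirichletGroup lam β) (n : ℕ) (t : ℝ) :
    characterHom (hG.character n) (β (Multiplicative.ofAdd t))
      = Complex.exp (-Complex.I * lam n * t) :=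
  hG.character_apply n t

theorem IsDirichletGroup.character_injective (hG : IsDirichletGroup lam β)
    (hlam : Function.Injective lam) : Function.Injective hG.character := by
  intro n m hnm
  by_contra hne
  have hd : lam n - lam m ≠ 0 := sub_ne_zero.2 fun h => hne (hlam h)
  -- At this time the two exponentials are opposite.
  have h1 := hG.characterHom_apply_flow n (Real.pi / (lam n - lam m))
  rw [hnm, hG.characterHom_apply_flow m] at h1
  have h2 : Complex.exp (-Complex.I * lam m * ((Real.pi / (lam n - lam m) : ℝ) : ℂ))
      = -Complex.exp (-Complex.I * lam n * ((Real.pi / (lam n - lam m) : ℝ) : ℂ)) := by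
    rw [← neg_one_mul (Complex.exp _), ← Complex.exp_pi_mul_I, ← Complex.exp_add]
    congr 1
    have hd' : (lam n : ℂ) - lam m ≠ 0 := by exact_mod_cast hd
    push_cast
    field_simp
    ring
  rw [h2] at h1
  exact Complex.exp_ne_zero _ (neg_eq_self.1 h1)

/-- Convolution with a character extracts one Fourier coefficient of `f`, which vanishes off the
spectrum. Only finitely many characters occur in `P`, whence `R₀`. -/
theorem exists_convolution_eq_sum (hG : IsDirichletGroup lam β) (hlam : Function.Injective lam)
    {f : G → ℂ} (hf : Integrable f μ)
    (hspec : ∀ χ, fourierCoefficient μ f χ ≠ 0 → χ ∈ Set.range hG.character)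
    {P : G → ℂ} (hP : P ∈ posTrig G) :
    ∃ R₀ : ℕ, ∀ R ≥ R₀, ∀ ω, ∫ y, f y * P (ω * y⁻¹) ∂μ
      = ∑ n ∈ Finset.range R, fourierCoefficient μ f (hG.character n)
        * fourierCoefficient μ P (hG.character n) * characterHom (hG.character n) ω := by
  classical
  refine posTrig_induction (motive := fun P => ∃ R₀ : ℕ, ∀ R ≥ R₀, ∀ ω,
    ∫ y, f y * P (ω * y⁻¹) ∂μ = ∑ n ∈ Finset.range R, fourierCoefficient μ f (hG.character n)
        * fourierCoefficient μ P (hG.character n) * characterHom (hG.character n) ω)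
    (fun χ => ?_) ⟨0, fun R _ ω => by simp [fourierCoefficient]⟩
    (fun P hP Q hQ h h' => ?_) hP
  · have hconv : ∀ ω, ∫ y, f y * characterHom χ (ω * y⁻¹) ∂μ
        = fourierCoefficient μ f χ * characterHom χ ω := by
      intro ω
      simp_rw [characterHom_mul, characterHom_inv, mul_left_comm (f _)]
      rw [integral_const_mul, mul_comm]
      rfl
    simp_rw [hconv, fourierCoefficient_characterHom]
    by_cases hχ : ∃ n₀, hG.character n₀ = χ
    · obtain ⟨n₀, rfl⟩ := hχ
      refine ⟨n₀ + 1, fun R hR ω => ?_⟩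
      rw [Finset.sum_eq_single n₀]
      · simp
      · intro n _ hn
        rw [if_neg fun h => hn (hG.character_injective hlam h).symm]
        simp
      · intro hn
        exact absurd (Finset.mem_range.2 (by omega)) hn
    · refine ⟨0, fun R _ ω => ?_⟩
      have h0 : fourierCoefficient μ f χ = 0 := by
        by_contra hne
        exact hχ (hspec χ hne)
      rw [h0, zero_mul, Finset.sum_eq_zero]
      intro n _
      rw [if_neg fun h => hχ ⟨n, h.symm⟩]
      simp
  · obtain ⟨R₁, h₁⟩ := h
    obtain ⟨R₂, h₂⟩ := h'
    have hPc := continuous_of_mem_posTrig hP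
    have hQc := continuous_of_mem_posTrig hQ
    have hint : ∀ (F : G → ℂ), Continuous F → ∀ ω, Integrable (fun y => f y * F (ω * y⁻¹)) μ := by
      intro F hF ω
      obtain ⟨c, hc⟩ := isCompact_univ.exists_bound_of_continuousOn hF.continuousOn
      have hF' : Continuous fun y => F (ω * y⁻¹) := by fun_prop
      exact hf.mul_bdd hF'.measurable.aestronglyMeasurable (ae_of_all _ fun y => hc _ trivial)
    refine ⟨max R₁ R₂, fun R hR ω => ?_⟩
    simp only [Pi.add_apply, mul_add, fourierCoefficient_add μ (integrable_of_continuous μ hPc)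
      (integrable_of_continuous μ hQc), add_mul, Finset.sum_add_distrib]
    rw [integral_add (hint P hPc ω) (hint Q hQc ω), h₁ R (le_of_max_le_left hR),
      h₂ R (le_of_max_le_right hR)]

/-- A nonnegative trigonometric polynomial acts on `L_p` by convolution with norm at most its
integral. -/
theorem eLpNorm_convolution_le {P : G → ℝ} (hP : (fun ω => (P ω : ℂ)) ∈ posTrig G)
    (hP0 : ∀ ω, 0 ≤ P ω) (hZ : 0 < ∫ ω, P ω ∂μ) {f : G → ℂ} {p : ℝ≥0∞} (hp : 1 ≤ p)
    (hf : AEStronglyMeasurable f μ) :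
    eLpNorm (fun ω => ((∫ ω, P ω ∂μ : ℝ) : ℂ)⁻¹ * ∫ y, f y * (P (ω * y⁻¹) : ℂ) ∂μ) p μ
      ≤ eLpNorm f p μ := by
  set Z := ∫ ω, P ω ∂μ with hZdef
  have hPc := continuous_of_coe_mem_posTrig hP
  set k : G → G → ℝ≥0∞ := fun ω y => ENNReal.ofReal (Z⁻¹ * P (ω * y⁻¹)) with hk
  have hkm : Measurable (Function.uncurry k) := by
    have := Complex.measurable_re.comp (measurable_of_mem_posTrig hP)
    simp only [Function.comp_def, Complex.ofReal_re] at this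
    exact (this.const_mul Z⁻¹).ennreal_ofReal
  have hk_int : ∀ φ : G → G, Continuous φ → ∫ y, P (φ y) ∂μ = Z →
      ∫⁻ y, ENNReal.ofReal (Z⁻¹ * P (φ y)) ∂μ = 1 := by
    intro φ hφ h
    rw [← ofReal_integral_eq_lintegral_ofReal
      (integrable_of_continuous_real μ (by fun_prop))
      (ae_of_all _ fun y => mul_nonneg (inv_nonneg.2 hZ.le) (hP0 _)), integral_const_mul, h,
      inv_mul_cancel₀ hZ.ne', ENNReal.ofReal_one]
  have hk₁ : ∀ ω, ∫⁻ y, k ω y ∂μ = 1 := fun ω => hk_int (fun y => ω * y⁻¹) (by fun_prop) (by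
    have := integral_mul_inv_left_of_mem_posTrig μ hP ω
    simp only [integral_complex_ofReal] at this
    exact_mod_cast this)
  have hk₂ : ∀ y, ∫⁻ ω, k ω y ∂μ = 1 := fun y => hk_int (fun ω => ω * y⁻¹) (by fun_prop)
    (integral_mul_right_eq_self P y⁻¹)
  refine le_trans ?_ ((eLpNorm_lintegral_kernel_le μ hkm hk₁ hk₂ hf.enorm hp).trans
    (le_of_eq (eLpNorm_enorm f)))
  refine eLpNorm_mono_enorm fun ω => ?_
  rw [enorm_eq_self, ← integral_const_mul]
  refine (enorm_integral_le_lintegral_enorm _).trans (le_of_eq (lintegral_congr fun y => ?_))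
  rw [enorm_mul, enorm_mul, mul_left_comm, hk]
  simp only
  rw [← enorm_mul, ← Complex.ofReal_inv, ← Complex.ofReal_mul,
    ← Real.enorm_of_nonneg (mul_nonneg (inv_nonneg.2 hZ.le) (hP0 _))]
  congr 1
  simp only [enorm, nnnorm, Complex.norm_real]

/-- A function of `H_p^lam` is approximated, coefficient by coefficient, by Dirichlet polynomials
of no larger norm. -/
theorem MemHardy.exists_dirichletPolynomial {hG : IsDirichletGroup lam β}
    (hlam : Function.Injective lam) {p : ℝ≥0∞} (hp : 1 ≤ p) {f : G → ℂ}
    (hf : MemHardy hG μ p f) (N : ℕ) {ε : ℝ} (hε : 0 < ε) :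
    ∃ (R : ℕ) (a : ℕ → ℂ), (∀ n ≥ R, a n = 0) ∧
      eLpNorm (fun ω => ∑ n ∈ Finset.range R, a n * characterHom (hG.character n) ω) p μ
        ≤ eLpNorm f p μ ∧
      ∀ n < N, ‖a n - fourierCoefficient μ f (hG.character n)‖ ≤ ε := by
  have hfi : Integrable f μ := hf.memLp.integrable hp
  set b := ∫ ω, ‖f ω‖ ∂μ with hb
  have hb0 : 0 ≤ b := integral_nonneg fun ω => norm_nonneg _
  -- The coefficient error is a relative one times a coefficient of `f`, itself at most `b`; the `+
  -- 1` covers `b = 0`.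
  obtain ⟨P, hP, hP0, hZ, hcoef⟩ := exists_posTrig_fourierCoefficient_sub_le μ hG.character N
    (show 0 < ε / (b + 1) by positivity)
  set Z := ∫ ω, P ω ∂μ with hZdef
  obtain ⟨R₀, hR₀⟩ := exists_convolution_eq_sum μ hG hlam hfi hf.spectrum hP
  set c : ℕ → ℂ := fun n => fourierCoefficient μ f (hG.character n)
    * fourierCoefficient μ (fun ω => (P ω : ℂ)) (hG.character n) with hc
  have hZc : (Z : ℂ) ≠ 0 := by exact_mod_cast hZ.ne'
  refine ⟨max R₀ N, fun n => if n < max R₀ N then (Z : ℂ)⁻¹ * c n else 0,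
    fun n hn => if_neg (not_lt.2 hn), ?_, fun n hn => ?_⟩
  · have heq : (fun ω => ∑ n ∈ Finset.range (max R₀ N),
        (if n < max R₀ N then (Z : ℂ)⁻¹ * c n else 0) * characterHom (hG.character n) ω)
        = fun ω => (Z : ℂ)⁻¹ * ∫ y, f y * (P (ω * y⁻¹) : ℂ) ∂μ := by
      ext ω
      rw [hR₀ _ (le_max_left _ _) ω, Finset.mul_sum]
      refine Finset.sum_congr rfl fun n hn => ?_
      rw [if_pos (Finset.mem_range.1 hn), mul_assoc]
    rw [heq]
    exact eLpNorm_convolution_le μ hP hP0 hZ hp hf.memLp.aestronglyMeasurable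
  · simp only [if_pos (lt_of_lt_of_le hn (le_max_right _ _)), hc]
    have h1 : (Z : ℂ)⁻¹ * (fourierCoefficient μ f (hG.character n)
        * fourierCoefficient μ (fun ω => (P ω : ℂ)) (hG.character n))
        - fourierCoefficient μ f (hG.character n)
        = fourierCoefficient μ f (hG.character n) * ((Z : ℂ)⁻¹ *
          (fourierCoefficient μ (fun ω => (P ω : ℂ)) (hG.character n) - Z)) := by
      rw [mul_sub, inv_mul_cancel₀ hZc]; ring
    have h2 := norm_fourierCoefficient_le μ f (hG.character n)
    have h3 : ‖(Z : ℂ)⁻¹ * (fourierCoefficient μ (fun ω => (P ω : ℂ)) (hG.character n) - Z)‖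
        ≤ ε / (b + 1) := by
      rw [norm_mul, norm_inv, Complex.norm_real, Real.norm_of_nonneg hZ.le,
        inv_mul_le_iff₀ hZ, mul_comm]
      exact hcoef n hn
    rw [h1, norm_mul]
    calc _ ≤ b * (ε / (b + 1)) := mul_le_mul h2 h3 (norm_nonneg _) hb0
      _ ≤ ε := by
        rw [mul_div_assoc', div_le_iff₀ (by positivity)]
        nlinarith

end Group

/-! ### Summation by parts -/

theorem sum_range_succ_mul_eq (b x : ℕ → ℂ) (N : ℕ) :
    ∑ n ∈ Finset.range (N + 1), b n * x n
      = ∑ i ∈ Finset.range N, (b i - b (i + 1)) * ∑ j ∈ Finset.range (i + 1), x j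
        + b N * ∑ j ∈ Finset.range (N + 1), x j := by
  induction N with
  | zero => simp
  | succ N ih =>
    rw [Finset.sum_range_succ, ih,
      Finset.sum_range_succ (fun i => (b i - b (i + 1)) * ∑ j ∈ Finset.range (i + 1), x j) N,
      Finset.sum_range_succ x (N + 1)]
    ring

theorem norm_sum_antitone_mul_le {b : ℕ → ℝ} (hb : Antitone b) (hb0 : ∀ n, 0 ≤ b n)
    {x : ℕ → ℂ} {M : ℝ} (hb1 : b 0 ≤ 1) (hx : ∀ N, ‖∑ n ∈ Finset.range N, x n‖ ≤ M) (N : ℕ) :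
    ‖∑ n ∈ Finset.range N, (b n : ℂ) * x n‖ ≤ M := by
  have hM : 0 ≤ M := (norm_nonneg _).trans (hx 0)
  cases N with
  | zero => simpa using hM
  | succ N =>
    rw [sum_range_succ_mul_eq]
    calc _ ≤ ∑ i ∈ Finset.range N, (b i - b (i + 1)) * M + b N * M := by
          refine (norm_add_le _ _).trans (add_le_add ((norm_sum_le _ _).trans
            (Finset.sum_le_sum fun i _ => ?_)) ?_)
          · rw [norm_mul, ← Complex.ofReal_sub, Complex.norm_real,
              Real.norm_of_nonneg (sub_nonneg.2 (hb i.le_succ))]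
            exact mul_le_mul_of_nonneg_left (hx _) (sub_nonneg.2 (hb i.le_succ))
          · rw [norm_mul, Complex.norm_real, Real.norm_of_nonneg (hb0 N)]
            exact mul_le_mul_of_nonneg_left (hx _) (hb0 N)
      _ = b 0 * M := by rw [← Finset.sum_mul, Finset.sum_range_sub']; ring
      _ ≤ M := mul_le_of_le_one_left hM hb1

/-- Squaring the weight provides two factors: one is spent on `w * ‖X‖ ≤ M`, the other leaves a
telescoping difference. This is why half of `u` is reserved for each purpose. -/
theorem norm_sub_sq_mul_le {w w' M : ℝ} {X : ℂ} (hw' : 0 ≤ w') (hw : w' ≤ w)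
    (hX : w * ‖X‖ ≤ M) : ‖(((w ^ 2 : ℝ) : ℂ) - ((w' ^ 2 : ℝ) : ℂ)) * X‖ ≤ 2 * M * (w - w') := by
  have h1 : w ^ 2 - w' ^ 2 ≤ 2 * w * (w - w') := by nlinarith
  have h2 : 0 ≤ w ^ 2 - w' ^ 2 := by nlinarith
  rw [norm_mul, ← Complex.ofReal_sub, Complex.norm_real, Real.norm_of_nonneg h2]
  calc _ ≤ 2 * w * (w - w') * ‖X‖ := mul_le_mul_of_nonneg_right h1 (norm_nonneg _)
    _ = 2 * (w * ‖X‖) * (w - w') := by ring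
    _ ≤ _ := by
      have := mul_le_mul_of_nonneg_right hX (sub_nonneg.2 hw)
      linarith

theorem norm_sum_sq_mul_le {w : ℕ → ℝ} (hw : Antitone w) (hw0 : ∀ n, 0 ≤ w n) (hw1 : w 0 ≤ 1)
    {x : ℕ → ℂ} {M : ℝ} (hx : ∀ n, w n * ‖∑ j ∈ Finset.range (n + 1), x j‖ ≤ M) (N : ℕ) :
    ‖∑ n ∈ Finset.range N, ((w n ^ 2 : ℝ) : ℂ) * x n‖ ≤ 2 * M := by
  have hM : 0 ≤ M := (mul_nonneg (hw0 0) (norm_nonneg _)).trans (hx 0)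
  cases N with
  | zero => simpa using hM
  | succ N =>
    rw [sum_range_succ_mul_eq fun n => ((w n ^ 2 : ℝ) : ℂ)]
    calc _ ≤ ∑ i ∈ Finset.range N, 2 * M * (w i - w (i + 1)) + w N * M := by
          refine (norm_add_le _ _).trans (add_le_add ((norm_sum_le _ _).trans
            (Finset.sum_le_sum fun i _ => norm_sub_sq_mul_le (hw0 _) (hw i.le_succ) (hx i))) ?_)
          rw [norm_mul, Complex.norm_real, Real.norm_of_nonneg (sq_nonneg _), sq, mul_assoc]
          exact mul_le_mul_of_nonneg_left (hx N) (hw0 N)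
      _ = 2 * M * w 0 - M * w N := by
          rw [← Finset.mul_sum, Finset.sum_range_sub']; ring
      _ ≤ _ := by nlinarith [mul_nonneg hM (hw0 N)]

theorem tendsto_sum_sq_mul {w : ℕ → ℝ} (hw : Antitone w) (hw0 : ∀ n, 0 ≤ w n)
    (hlim : Tendsto w atTop (𝓝 0)) {x : ℕ → ℂ} {M : ℝ}
    (hx : ∀ n, w n * ‖∑ j ∈ Finset.range (n + 1), x j‖ ≤ M) :
    ∃ L : ℂ, Tendsto (fun N => ∑ n ∈ Finset.range N, ((w n ^ 2 : ℝ) : ℂ) * x n) atTop (𝓝 L) := by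
  have hM : 0 ≤ M := (mul_nonneg (hw0 0) (norm_nonneg _)).trans (hx 0)
  set d : ℕ → ℂ := fun i => (((w i ^ 2 : ℝ) : ℂ) - ((w (i + 1) ^ 2 : ℝ) : ℂ))
    * ∑ j ∈ Finset.range (i + 1), x j with hd
  have hsum : Summable d := by
    refine Summable.of_norm (summable_of_sum_range_le (c := 2 * M * w 0)
      (fun _ => norm_nonneg _) fun N => ?_)
    calc _ ≤ ∑ i ∈ Finset.range N, 2 * M * (w i - w (i + 1)) :=
          Finset.sum_le_sum fun i _ => norm_sub_sq_mul_le (hw0 _) (hw i.le_succ) (hx i)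
      _ = 2 * M * (w 0 - w N) := by rw [← Finset.mul_sum, Finset.sum_range_sub']
      _ ≤ _ := by
        have := mul_nonneg hM (hw0 N)
        linarith
  have hend : Tendsto (fun N => ((w N ^ 2 : ℝ) : ℂ) * ∑ j ∈ Finset.range (N + 1), x j) atTop
      (𝓝 0) := by
    refine squeeze_zero_norm (a := fun N => w N * M) (fun N => ?_) (by simpa using hlim.mul_const M)
    rw [norm_mul, Complex.norm_real, Real.norm_of_nonneg (sq_nonneg _), sq, mul_assoc]
    exact mul_le_mul_of_nonneg_left (hx N) (hw0 N)
  refine ⟨∑' i, d i, ?_⟩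
  rw [← tendsto_add_atTop_iff_nat 1]
  simp_rw [sum_range_succ_mul_eq fun n => ((w n ^ 2 : ℝ) : ℂ)]
  have h := hsum.hasSum.tendsto_sum_nat.add hend
  rwa [add_zero] at h

/-! ### `L_p` norms of suprema -/

/-- Monotone convergence for finite `p`, a countable union of null sets for `p = ∞`. -/
theorem eLpNorm_iSup_le {X : Type*} [MeasurableSpace X] (μ : Measure X) {F : ℕ → X → ℝ≥0∞}
    (hF : ∀ n, Measurable (F n)) (hmono : Monotone F) {p : ℝ≥0∞} (hp : p ≠ 0) {B : ℝ≥0∞}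
    (hB : ∀ n, eLpNorm (F n) p μ ≤ B) : eLpNorm (fun x => ⨆ n, F n x) p μ ≤ B := by
  rcases eq_or_ne p ⊤ with rfl | hpt
  · simp only [eLpNorm_exponent_top] at hB ⊢
    refine eLpNormEssSup_le_of_ae_enorm_bound ?_
    have : ∀ᵐ x ∂μ, ∀ n, ‖F n x‖ₑ ≤ B := ae_all_iff.2 fun n =>
      (enorm_ae_le_eLpNormEssSup (F n) μ).mono fun x hx => hx.trans (hB n)
    filter_upwards [this] with x hx
    exact iSup_le hx
  · have hpr : 0 < p.toReal := ENNReal.toReal_pos hp hpt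
    have hB' : ∀ n, ∫⁻ x, F n x ^ p.toReal ∂μ ≤ B ^ p.toReal := fun n => by
      have := hB n
      rw [eLpNorm_eq_lintegral_rpow_enorm_toReal hp hpt, one_div,
        ENNReal.rpow_inv_le_iff hpr] at this
      simpa only [enorm_eq_self] using this
    rw [eLpNorm_eq_lintegral_rpow_enorm_toReal hp hpt, one_div, ENNReal.rpow_inv_le_iff hpr]
    simp only [enorm_eq_self]
    have hsup : ∀ x, (⨆ n, F n x) ^ p.toReal = ⨆ n, F n x ^ p.toReal := fun x =>
      (ENNReal.orderIsoRpow p.toReal hpr).map_iSup fun n => F n x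
    simp_rw [hsup]
    rw [lintegral_iSup (fun n => (hF n).pow_const _)
      fun n m hnm x => ENNReal.rpow_le_rpow (hmono hnm x) hpr.le]
    exact iSup_le hB'

section Group

variable {G : Type*} [CommGroup G] [TopologicalSpace G] [MeasurableSpace G] [BorelSpace G]
  [IsTopologicalGroup G] [CompactSpace G] (μ : Measure G) [μ.IsHaarMeasure]
  [IsProbabilityMeasure μ] {lam : ℕ → ℝ} {β : Multiplicative ℝ →ₜ* G}

/-! ### Averages along the flow -/

/-- Averaging along the flow against an integrable weight is bounded on `L_p`. -/
theorem eLpNorm_flow_average_le {D : G → ℂ} (hD : Continuous D)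
    (hDm : Measurable fun z : G × ℝ => D (z.1 * β (Multiplicative.ofAdd z.2))) {g : ℝ → ℝ≥0∞}
    (hg : Measurable g) {p : ℝ≥0∞} (hp : 1 ≤ p) :
    eLpNorm (fun ω => ∫⁻ t, ‖D (ω * β (Multiplicative.ofAdd t))‖ₑ * g t) p μ
      ≤ (∫⁻ t, g t) * eLpNorm D p μ := by
  rcases eq_or_ne p ⊤ with rfl | hpt
  · rw [eLpNorm_exponent_top, eLpNorm_exponent_top]
    -- Haar measure charges nonempty open sets, so the essential bound of the continuous `D` holds
    -- everywhere, in particular along each orbit.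
    have hopen : IsOpen {ω | eLpNormEssSup D μ < ‖D ω‖ₑ} := isOpen_lt continuous_const hD.enorm
    have hnull : μ {ω | eLpNormEssSup D μ < ‖D ω‖ₑ} = 0 := by
      have := enorm_ae_le_eLpNormEssSup D μ
      simpa only [ae_iff, not_le] using this
    have hle : ∀ ω, ‖D ω‖ₑ ≤ eLpNormEssSup D μ := fun ω => by
      by_contra h
      have hω : ω ∈ {ω | eLpNormEssSup D μ < ‖D ω‖ₑ} := not_le.1 h
      rw [(hopen.measure_eq_zero_iff μ).1 hnull] at hω
      exact hω
    refine eLpNormEssSup_le_of_ae_enorm_bound (ae_of_all _ fun ω => ?_)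
    rw [enorm_eq_self, mul_comm, ← lintegral_const_mul _ hg]
    exact lintegral_mono fun t => mul_le_mul_left (hle _) _
  · have hp0 : p ≠ 0 := (zero_lt_one.trans_le hp).ne'
    have hpr : 1 ≤ p.toReal := by simpa using ENNReal.toReal_mono hpt hp
    have hpr0 : 0 < p.toReal := by linarith
    rw [eLpNorm_eq_lintegral_rpow_enorm_toReal hp0 hpt, one_div, ENNReal.rpow_inv_le_iff hpr0,
      eLpNorm_eq_lintegral_rpow_enorm_toReal hp0 hpt, ENNReal.mul_rpow_of_nonneg _ _ hpr0.le,
      ← ENNReal.rpow_mul, one_div_mul_cancel hpr0.ne', ENNReal.rpow_one]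
    simp only [enorm_eq_self]
    refine (lintegral_lintegral_mul_rpow_le μ volume
      (H := fun ω t => ‖D (ω * β (Multiplicative.ofAdd t))‖ₑ) (k := fun _ t => g t)
      (A := ∫⁻ t, g t) hDm.enorm (hg.comp measurable_snd) (fun _ => le_rfl) hpr).trans ?_
    have hin : ∀ t, ∫⁻ ω, ‖D (ω * β (Multiplicative.ofAdd t))‖ₑ ^ p.toReal * g t ∂μ
        = (∫⁻ ω, ‖D ω‖ₑ ^ p.toReal ∂μ) * g t := fun t => by
      have hc : Continuous fun ω => D (ω * β (Multiplicative.ofAdd t)) := by fun_prop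
      rw [lintegral_mul_const _ (hc.measurable.enorm.pow_const _),
        lintegral_mul_right_eq_self (fun ω => ‖D ω‖ₑ ^ p.toReal)]
    simp_rw [hin]
    rw [lintegral_const_mul _ hg, mul_left_comm, mul_comm (∫⁻ ω, ‖D ω‖ₑ ^ p.toReal ∂μ)]
    refine mul_le_mul_left (le_of_eq ?_) _
    rcases eq_or_ne (∫⁻ t, g t) 0 with h0 | h0
    · rw [h0, mul_zero, ENNReal.zero_rpow_of_pos hpr0]
    rcases eq_or_ne (∫⁻ t, g t) ⊤ with h1 | h1
    · rw [h1, ENNReal.top_rpow_of_pos hpr0, ENNReal.mul_top]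
      rcases hpr.eq_or_lt with h | h
      · rw [← h]; simp
      · rw [ENNReal.top_rpow_of_pos (by linarith)]; simp
    · conv_lhs => rw [← ENNReal.rpow_one (∫⁻ t, g t), ← ENNReal.rpow_mul, ← ENNReal.rpow_add _ _ h0 h1]
      ring_nf

end Group

section Group

variable {G : Type*} [CommGroup G] [TopologicalSpace G] {lam : ℕ → ℝ}
  {β : Multiplicative ℝ →ₜ* G}

/-! ### The maximal inequality for Dirichlet polynomials -/

/-- The sum of the first `N` terms of `∑ a_n h_{lam_n}`. -/
def dirichletSum (hG : IsDirichletGroup lam β) (a : ℕ → ℂ) (N : ℕ) (ω : G) : ℂ :=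
  ∑ n ∈ Finset.range N, a n * characterHom (hG.character n) ω

/-- The modulus of `exp (-v lam_n)` times the sum of the terms of index at most `n`. -/
def dampedSum (hG : IsDirichletGroup lam β) (v : ℝ) (a : ℕ → ℂ) (n : ℕ) (ω : G) : ℝ≥0∞ :=
  ENNReal.ofReal (Real.exp (-v * lam n) * ‖dirichletSum hG a (n + 1) ω‖)

theorem continuous_dirichletSum (hG : IsDirichletGroup lam β) (a : ℕ → ℂ) (N : ℕ) :
    Continuous (dirichletSum hG a N) :=
  continuous_finsetSum _ fun _ _ => continuous_const.mul (continuous_characterHom _)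

theorem dirichletSum_flow (hG : IsDirichletGroup lam β) (a : ℕ → ℂ) (N : ℕ) (ω : G) (t : ℝ) :
    dirichletSum hG a N (ω * β (Multiplicative.ofAdd t)) = ∑ n ∈ Finset.range N,
      a n * characterHom (hG.character n) ω * Complex.exp (-Complex.I * lam n * t) := by
  refine Finset.sum_congr rfl fun n _ => ?_
  rw [characterHom_mul, mul_assoc]
  congr 2
  exact hG.character_apply n t

theorem dirichletSum_eq_of_le (hG : IsDirichletGroup lam β) {a : ℕ → ℂ} {R : ℕ}
    (ha : ∀ n ≥ R, a n = 0) {N : ℕ} (hN : R ≤ N) : dirichletSum hG a N = dirichletSum hG a R := by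
  ext ω
  refine (Finset.sum_subset (Finset.range_mono hN) fun n _ hn => ?_).symm
  rw [ha n (by simpa using hn), zero_mul]

variable [MeasurableSpace G] [BorelSpace G]

theorem measurable_dampedSum (hG : IsDirichletGroup lam β) (v : ℝ) (a : ℕ → ℂ) (n : ℕ) :
    Measurable (dampedSum hG v a n) :=
  (((continuous_dirichletSum hG a (n + 1)).norm.measurable).const_mul _).ennreal_ofReal

theorem measurable_dirichletSum_flow (hG : IsDirichletGroup lam β) (a : ℕ → ℂ) (N : ℕ) :
    Measurable fun z : G × ℝ => dirichletSum hG a N (z.1 * β (Multiplicative.ofAdd z.2)) := by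
  simp_rw [dirichletSum_flow]
  refine Finset.measurable_sum _ fun n _ => Measurable.mul ?_ (by fun_prop)
  exact ((continuous_characterHom _).measurable.comp measurable_fst).const_mul _

theorem integral_dirichletSum_flow_mul_trapKernel (hG : IsDirichletGroup lam β) (a : ℕ → ℂ)
    (N : ℕ) (x b : ℝ) (ω : G) :
    ∫ t : ℝ, dirichletSum hG a N (ω * β (Multiplicative.ofAdd t)) * (trapKernel x b t : ℂ)
      = ∑ n ∈ Finset.range N, a n * characterHom (hG.character n) ω * trap x b (lam n) := by
  simp_rw [dirichletSum_flow, Finset.sum_mul]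
  rw [integral_finsetSum]
  · refine Finset.sum_congr rfl fun n _ => ?_
    rw [← integral_trapKernel_mul_exp, ← integral_const_mul]
    refine integral_congr_ae (ae_of_all _ fun t => ?_)
    simp only
    ring
  · intro n _
    have hK : Integrable fun t => (trapKernel x b t : ℂ) := (integrable_trapKernel x b).ofReal
    refine Integrable.bdd_mul (c := ‖a n * characterHom (hG.character n) ω‖) hK (by fun_prop)
      (ae_of_all _ fun t => ?_)
    rw [norm_mul, show -Complex.I * (lam n : ℂ) * (t : ℂ) = ((-(lam n * t) : ℝ) : ℂ) * Complex.I by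
      push_cast; ring, Complex.norm_exp_ofReal_mul_I, mul_one]

variable [IsTopologicalGroup G] [CompactSpace G] (μ : Measure G) [μ.IsHaarMeasure]
  [IsProbabilityMeasure μ]

/-- By orthogonality `a n` is a Fourier coefficient of the polynomial. -/
theorem norm_coeff_le (hG : IsDirichletGroup lam β) (hlam : Function.Injective lam) {a : ℕ → ℂ}
    {R : ℕ} (ha : ∀ n ≥ R, a n = 0) (n : ℕ) : ‖a n‖ ≤ ∫ ω, ‖dirichletSum hG a R ω‖ ∂μ := by
  classical
  refine le_trans (le_of_eq ?_)
    (norm_fourierCoefficient_le μ (dirichletSum hG a R) (hG.character n))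
  congr 1
  have hc := continuous_characterHom (G := G)
  rw [fourierCoefficient_eq]
  simp only [dirichletSum, Finset.sum_mul, mul_assoc]
  rw [integral_finsetSum]
  · simp_rw [integral_const_mul, ← fourierCoefficient_eq, fourierCoefficient_characterHom,
      (hG.character_injective hlam).eq_iff]
    rcases lt_or_ge n R with h | h
    · simp [h]
    · rw [ha n h, Finset.sum_eq_zero]
      intro m hm
      rw [if_neg (by have := Finset.mem_range.1 hm; omega), mul_zero]
  · intro m _
    refine integrable_of_continuous μ (continuous_const.mul ((hc _).mul ?_))
    exact Complex.continuous_conj.comp (hc _)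

theorem norm_dirichletSum_le (hG : IsDirichletGroup lam β) (hlam : IsFrequency lam) {a : ℕ → ℂ}
    {R : ℕ} (ha : ∀ n ≥ R, a n = 0) {n m : ℕ} (hnm : n < m) {b : ℝ} (hb : lam n < b)
    (hbm : b ≤ lam m) (ω : G) :
    ‖dirichletSum hG a (n + 1) ω‖
      ≤ ‖∫ t : ℝ, dirichletSum hG a R (ω * β (Multiplicative.ofAdd t))
          * (trapKernel (lam n) b t : ℂ)‖
        + ((m : ℝ) - n) * ∫ ω, ‖dirichletSum hG a R ω‖ ∂μ := by
  set I := ∫ ω, ‖dirichletSum hG a R ω‖ ∂μ with hI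
  have hI0 : 0 ≤ I := integral_nonneg fun ω => norm_nonneg _
  -- Padding with zero coefficients up to `max R m` allows a cut at `m` even when `m > R`.
  have hR := dirichletSum_eq_of_le hG ha (le_max_left R m)
  have hn1 : n + 1 ≤ m := hnm
  set T : ℕ → ℂ := fun j => a j * characterHom (hG.character j) ω * trap (lam n) b (lam j) with hT
  have h1 : ∑ j ∈ Finset.range (max R m), T j
      = dirichletSum hG a (n + 1) ω + ∑ j ∈ Finset.Ico (n + 1) m, T j := by
    have h2 : ∑ j ∈ Finset.range (max R m), T j = ∑ j ∈ Finset.range m, T j := by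
      refine (Finset.sum_subset (Finset.range_mono (le_max_right R m)) fun j _ hj => ?_).symm
      have hj' : m ≤ j := by simpa using hj
      simp only [hT]
      rw [trap_eq_zero (hlam.nonneg n) hb (hbm.trans (hlam.strictMono.monotone hj'))]
      simp
    rw [h2, ← Finset.sum_range_add_sum_Ico _ hn1]
    congr 1
    refine Finset.sum_congr rfl fun j hj => ?_
    simp only [hT]
    rw [trap_eq_one hb (hlam.nonneg j)
      (hlam.strictMono.monotone (Nat.lt_succ_iff.1 (Finset.mem_range.1 hj)))]
    simp
  have h3 : ‖∑ j ∈ Finset.Ico (n + 1) m, T j‖ ≤ ((m : ℝ) - n) * I := by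
    calc _ ≤ ∑ j ∈ Finset.Ico (n + 1) m, I := by
          refine (norm_sum_le _ _).trans (Finset.sum_le_sum fun j _ => ?_)
          simp only [hT]
          rw [norm_mul, norm_mul, norm_characterHom, mul_one, Complex.norm_real]
          calc _ ≤ I * 1 := mul_le_mul (norm_coeff_le μ hG hlam.strictMono.injective ha j)
                (abs_trap_le_one _ hb) (abs_nonneg _) hI0
            _ = I := mul_one I
      _ = ((m : ℝ) - (n + 1)) * I := by
          rw [Finset.sum_const, Nat.card_Ico, nsmul_eq_mul, Nat.cast_sub hn1]; push_cast; ring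
      _ ≤ _ := mul_le_mul_of_nonneg_right (by linarith) hI0
  rw [← hR, integral_dirichletSum_flow_mul_trapKernel, h1]
  have h4 := norm_sub_le (dirichletSum hG a (n + 1) ω + ∑ j ∈ Finset.Ico (n + 1) m, T j)
    (∑ j ∈ Finset.Ico (n + 1) m, T j)
  rw [add_sub_cancel_right] at h4
  linarith

/-- The right-hand side no longer depends on `n`, so it also dominates the supremum. -/
theorem dampedSum_le (hG : IsDirichletGroup lam β) (hlam : IsFrequency lam) {a : ℕ → ℂ}
    {R : ℕ} (ha : ∀ n ≥ R, a n = 0) {v A B C : ℝ} {n m : ℕ} (hnm : n < m) {b : ℝ}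
    (hb : lam n < b) (hbm : b ≤ lam m) (hC : Real.exp (-v * lam n) * ((m : ℝ) - n) ≤ C)
    (hK : ∀ t, Real.exp (-v * lam n) * |trapKernel (lam n) b t| ≤ logMajorant A B t) (ω : G) :
    dampedSum hG v a n ω
      ≤ (∫⁻ t, ‖dirichletSum hG a R (ω * β (Multiplicative.ofAdd t))‖ₑ
          * ENNReal.ofReal (logMajorant A B t))
        + ENNReal.ofReal C * eLpNorm (dirichletSum hG a R) 1 μ := by
  have hw := Real.exp_pos (-v * lam n)
  set w := Real.exp (-v * lam n)
  have hI : eLpNorm (dirichletSum hG a R) 1 μ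
      = ENNReal.ofReal (∫ ω, ‖dirichletSum hG a R ω‖ ∂μ) := by
    rw [eLpNorm_one_eq_lintegral_enorm, ofReal_integral_norm_eq_lintegral_enorm
      (integrable_of_continuous μ (continuous_dirichletSum hG a R))]
  set I := ∫ ω, ‖dirichletSum hG a R ω‖ ∂μ
  have hI0 : 0 ≤ I := integral_nonneg fun ω => norm_nonneg _
  have hC0 : 0 ≤ C := le_trans (mul_nonneg hw.le (sub_nonneg.2 (by exact_mod_cast hnm.le))) hC
  have h1 := mul_le_mul_of_nonneg_left (norm_dirichletSum_le μ hG hlam ha hnm hb hbm ω) hw.le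
  rw [mul_add, ← mul_assoc] at h1
  have h2 := h1.trans (add_le_add le_rfl (mul_le_mul_of_nonneg_right hC hI0))
  refine (ENNReal.ofReal_le_ofReal h2).trans ?_
  rw [ENNReal.ofReal_add (by positivity) (by positivity), ENNReal.ofReal_mul hC0, hI]
  refine add_le_add_left ?_ _
  rw [ENNReal.ofReal_mul hw.le, ofReal_norm]
  calc _ ≤ ENNReal.ofReal w * ∫⁻ t, ‖dirichletSum hG a R (ω * β (Multiplicative.ofAdd t))
          * (trapKernel (lam n) b t : ℂ)‖ₑ :=
        mul_le_mul_right (enorm_integral_le_lintegral_enorm _) _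
    _ = ∫⁻ t, ENNReal.ofReal w * ‖dirichletSum hG a R (ω * β (Multiplicative.ofAdd t))
          * (trapKernel (lam n) b t : ℂ)‖ₑ :=
        (lintegral_const_mul' _ _ ENNReal.ofReal_ne_top).symm
    _ ≤ _ := by
        refine lintegral_mono fun t => ?_
        rw [enorm_mul, mul_left_comm]
        refine mul_le_mul_right ?_ _
        rw [← ofReal_norm (trapKernel (lam n) b t : ℂ), ← ENNReal.ofReal_mul hw.le,
          Complex.norm_real]
        exact ENNReal.ofReal_le_ofReal (hK t)

/-- The maximal inequality for Dirichlet polynomials, with a constant that depends only on the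
frequency and on `v`. -/
theorem exists_eLpNorm_iSup_dampedSum_le (hlam : IsFrequency lam) (hNC : NC lam) {v : ℝ}
    (hv : 0 < v) : ∃ K : ℝ≥0∞, K ≠ ⊤ ∧
      ∀ (G : Type*) [CommGroup G] [TopologicalSpace G] [IsTopologicalGroup G] [CompactSpace G]
        [MeasurableSpace G] [BorelSpace G] (μ : Measure G) [μ.IsHaarMeasure]
        [IsProbabilityMeasure μ] (β : Multiplicative ℝ →ₜ* G) (hG : IsDirichletGroup lam β)
        (p : ℝ≥0∞), 1 ≤ p → ∀ (a : ℕ → ℂ) (R : ℕ), (∀ n ≥ R, a n = 0) →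
          eLpNorm (fun ω => ⨆ n, dampedSum hG v a n ω) p μ
            ≤ K * eLpNorm (dirichletSum hG a R) p μ := by
  obtain ⟨A, B, C, h⟩ := hNC.exists_trapKernel_le hlam hv
  set g : ℝ → ℝ≥0∞ := fun t => ENNReal.ofReal (logMajorant A B t) with hgdef
  have hg : Measurable g := by
    refine Measurable.ennreal_ofReal (Measurable.ite ?_ (by fun_prop) (by fun_prop))
    exact measurableSet_le (by fun_prop) (by fun_prop)
  refine ⟨(∫⁻ t, g t) + ENNReal.ofReal C, ENNReal.add_ne_top.2
    ⟨(integrable_logMajorant A B).lintegral_lt_top.ne, ENNReal.ofReal_ne_top⟩, ?_⟩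
  intro G _ _ _ _ _ _ μ _ _ β hG p hp a R ha
  have hcont := continuous_dirichletSum hG a R
  have hm := measurable_dirichletSum_flow hG a R
  set D := dirichletSum hG a R with hD
  set Φ : G → ℝ≥0∞ := fun ω => ∫⁻ t, ‖D (ω * β (Multiplicative.ofAdd t))‖ₑ * g t with hΦ
  have hΦm : Measurable Φ :=
    (Measurable.mul hm.enorm (hg.comp measurable_snd)).lintegral_prod_right'
  have hpt : ∀ ω, ‖⨆ n, dampedSum hG v a n ω‖ₑ
      ≤ ‖Φ ω + ENNReal.ofReal C * eLpNorm D 1 μ‖ₑ := fun ω => by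
    rw [enorm_eq_self, enorm_eq_self]
    refine iSup_le fun n => ?_
    obtain ⟨m, hnm, b, hb, hbm, hC, hK⟩ := h n
    exact dampedSum_le μ hG hlam ha hnm hb hbm hC hK ω
  have hp0 : p ≠ 0 := (zero_lt_one.trans_le hp).ne'
  calc _ ≤ eLpNorm (Φ + fun _ => ENNReal.ofReal C * eLpNorm D 1 μ) p μ := eLpNorm_mono_enorm hpt
    _ ≤ eLpNorm Φ p μ + eLpNorm (fun _ : G => ENNReal.ofReal C * eLpNorm D 1 μ) p μ :=
        eLpNorm_add_le hΦm.aestronglyMeasurable aestronglyMeasurable_const hp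
    _ ≤ (∫⁻ t, g t) * eLpNorm D p μ + ENNReal.ofReal C * eLpNorm D p μ := by
        refine add_le_add (eLpNorm_flow_average_le μ hcont hm hg hp) ?_
        rw [eLpNorm_const _ hp0 (IsProbabilityMeasure.ne_zero μ), measure_univ,
          ENNReal.one_rpow, mul_one, enorm_eq_self]
        exact mul_le_mul_right
          (eLpNorm_le_eLpNorm_of_exponent_le hp hcont.measurable.aestronglyMeasurable) _
    _ = _ := (add_mul _ _ _).symm

/-! ### The maximal inequality in the Hardy space -/

theorem dampedSum_le_add (hG : IsDirichletGroup lam β) (hlam : IsFrequency lam) {v : ℝ}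
    (hv : 0 < v) {a c : ℕ → ℂ} {N : ℕ} {ε : ℝ} (hε : 0 ≤ ε) (hac : ∀ n < N, ‖a n - c n‖ ≤ ε)
    {n : ℕ} (hn : n < N) (ω : G) :
    dampedSum hG v c n ω ≤ dampedSum hG v a n ω + ENNReal.ofReal (N * ε) := by
  have hw : Real.exp (-v * lam n) ≤ 1 :=
    Real.exp_le_one_iff.2 (by nlinarith [hlam.nonneg n])
  have hw0 := Real.exp_pos (-v * lam n)
  unfold dampedSum
  rw [← ENNReal.ofReal_add (by positivity) (by positivity)]
  refine ENNReal.ofReal_le_ofReal ?_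
  have h1 : ‖dirichletSum hG a (n + 1) ω - dirichletSum hG c (n + 1) ω‖ ≤ N * ε := by
    unfold dirichletSum
    rw [← Finset.sum_sub_distrib]
    calc _ ≤ ∑ j ∈ Finset.range (n + 1), ε := by
          refine (norm_sum_le _ _).trans (Finset.sum_le_sum fun j hj => ?_)
          rw [← sub_mul, norm_mul, norm_characterHom, mul_one]
          exact hac j (by have := Finset.mem_range.1 hj; omega)
      _ = ((n + 1 : ℕ) : ℝ) * ε := by rw [Finset.sum_const, Finset.card_range, nsmul_eq_mul]
      _ ≤ _ := mul_le_mul_of_nonneg_right (by exact_mod_cast hn) hε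
  have h2 := norm_sub_norm_le (dirichletSum hG c (n + 1) ω) (dirichletSum hG a (n + 1) ω)
  rw [norm_sub_rev] at h2
  have h3 : 0 ≤ N * ε := by positivity
  nlinarith [mul_le_mul_of_nonneg_right hw h3]

/-- The supremum over `n < N` involves only `N` coefficients, so approximating these by a polynomial
of no larger norm costs an arbitrarily small `η`. -/
theorem MemHardy.eLpNorm_iSup_dampedSum_le {hG : IsDirichletGroup lam β} (hlam : IsFrequency lam)
    {v : ℝ} (hv : 0 < v) {p : ℝ≥0∞} (hp : 1 ≤ p) {K : ℝ≥0∞}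
    (hK : ∀ (a : ℕ → ℂ) (R : ℕ), (∀ n ≥ R, a n = 0) →
      eLpNorm (fun ω => ⨆ n, dampedSum hG v a n ω) p μ ≤ K * eLpNorm (dirichletSum hG a R) p μ)
    {f : G → ℂ} (hf : MemHardy hG μ p f) :
    eLpNorm (fun ω => ⨆ n,
      dampedSum hG v (fun n => fourierCoefficient μ f (hG.character n)) n ω) p μ
      ≤ K * eLpNorm f p μ := by
  have hp0 : p ≠ 0 := (zero_lt_one.trans_le hp).ne'
  set c : ℕ → ℂ := fun n => fourierCoefficient μ f (hG.character n)
  set F : ℕ → G → ℝ≥0∞ := fun N ω => ⨆ n, ⨆ _ : n < N, dampedSum hG v c n ω with hF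
  have hFm : ∀ N, Measurable (F N) := fun N =>
    Measurable.iSup fun n => Measurable.iSup fun _ => measurable_dampedSum hG v c n
  have hmono : Monotone F := fun N M hNM ω =>
    iSup_mono fun n => iSup_mono' fun h => ⟨lt_of_lt_of_le h hNM, le_rfl⟩
  have hsup : ∀ ω, ⨆ n, dampedSum hG v c n ω = ⨆ N, F N ω := fun ω => by
    refine le_antisymm (iSup_le fun n => ?_) (iSup_le fun N => iSup_le fun n => iSup_le fun _ =>
      le_iSup (fun n => dampedSum hG v c n ω) n)
    exact le_iSup_of_le (n + 1) (le_iSup₂_of_le n n.lt_succ_self le_rfl)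
  simp_rw [hsup]
  refine eLpNorm_iSup_le μ hFm hmono hp0 fun N => ?_
  refine ENNReal.le_of_forall_pos_le_add fun η hη _ => ?_
  have hε : 0 < (η : ℝ) / (N + 1) := by positivity
  obtain ⟨R, a, ha, hnorm, hac⟩ :=
    hf.exists_dirichletPolynomial μ hlam.strictMono.injective hp N hε
  have hNη : ENNReal.ofReal (N * ((η : ℝ) / (N + 1))) ≤ η := by
    rw [← ENNReal.ofReal_coe_nnreal]
    refine ENNReal.ofReal_le_ofReal ?_
    rw [mul_div_assoc', div_le_iff₀ (by positivity)]
    nlinarith [η.coe_nonneg]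
  have hpt : ∀ ω, ‖F N ω‖ₑ ≤ ‖(⨆ n, dampedSum hG v a n ω) + (η : ℝ≥0∞)‖ₑ :=
    fun ω => by
    rw [enorm_eq_self, enorm_eq_self]
    refine iSup₂_le fun n hn => ?_
    exact (dampedSum_le_add hG hlam hv hε.le hac hn ω).trans
      (add_le_add (le_iSup (fun n => dampedSum hG v a n ω) n) hNη)
  calc _ ≤ eLpNorm ((fun ω => ⨆ n, dampedSum hG v a n ω) + fun _ => (η : ℝ≥0∞)) p μ :=
        eLpNorm_mono_enorm hpt
    _ ≤ eLpNorm (fun ω => ⨆ n, dampedSum hG v a n ω) p μ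
        + eLpNorm (fun _ : G => (η : ℝ≥0∞)) p μ :=
        eLpNorm_add_le (Measurable.iSup fun n =>
          measurable_dampedSum hG v a n).aestronglyMeasurable aestronglyMeasurable_const hp
    _ ≤ K * eLpNorm f p μ + η := by
        refine add_le_add ((hK a R ha).trans (mul_le_mul_right hnorm _)) (le_of_eq ?_)
        rw [eLpNorm_const _ hp0 (IsProbabilityMeasure.ne_zero μ), measure_univ,
          ENNReal.one_rpow, mul_one, enorm_eq_self]

/-! ### From damped sums to the maximal function -/

section Pointwise

variable (hG : IsDirichletGroup lam β) (f : G → ℂ)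

theorem exp_mul_norm_dirichletSum_le {v : ℝ} {a : ℕ → ℂ} {ω : G}
    (h : ⨆ n, dampedSum hG v a n ω ≠ ⊤) (n : ℕ) :
    Real.exp (-v * lam n) * ‖dirichletSum hG a (n + 1) ω‖
      ≤ (⨆ n, dampedSum hG v a n ω).toReal := by
  rw [← ENNReal.ofReal_le_iff_le_toReal h]
  exact le_iSup (fun n => dampedSum hG v a n ω) n

theorem partialSum_eq (v : ℝ) (N : ℕ) (ω : G) :
    partialSum hG μ f (2 * v) N ω = ∑ n ∈ Finset.range N,
      ((Real.exp (-v * lam n) ^ 2 : ℝ) : ℂ)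
        * (fourierCoefficient μ f (hG.character n) * characterHom (hG.character n) ω) := by
  refine Finset.sum_congr rfl fun n _ => ?_
  rw [← Real.exp_nat_mul, characterHom_apply, show ((2 : ℕ) : ℝ) * (-v * lam n)
    = -(2 * v) * lam n by push_cast; ring]
  ring

theorem antitone_exp_neg_mul (hlam : IsFrequency lam) {v : ℝ} (hv : 0 ≤ v) :
    Antitone fun n => Real.exp (-v * lam n) := fun n m hnm =>
  Real.exp_le_exp.2 (by nlinarith [hlam.strictMono.monotone hnm])

/-- Two Abel summations: the squared weights `exp (-v * lam n) ^ 2` treat `σ = 2 * v`, and the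
remaining factor `exp (-(σ - 2 * v) * lam n)` is decreasing and at most `1`. -/
theorem maximalFunction_le (hlam : IsFrequency lam) {v : ℝ} (hv : 0 < v) (ω : G) :
    maximalFunction hG μ f (2 * v) ω
      ≤ 2 * ⨆ n, dampedSum hG v (fun n => fourierCoefficient μ f (hG.character n)) n ω := by
  set c : ℕ → ℂ := fun n => fourierCoefficient μ f (hG.character n) with hc
  set M := ⨆ n, dampedSum hG v c n ω with hM
  rcases eq_or_ne M ⊤ with h | h
  · rw [h, ENNReal.mul_top two_ne_zero]; exact le_top
  have hexp : ∀ s : ℝ, 0 ≤ s → Real.exp (-s * lam 0) ≤ 1 := fun s hs =>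
    Real.exp_le_one_iff.2 (by nlinarith [hlam.nonneg 0])
  have h2 : ∀ N, ‖∑ n ∈ Finset.range N, ((Real.exp (-v * lam n) ^ 2 : ℝ) : ℂ)
      * (c n * characterHom (hG.character n) ω)‖ ≤ 2 * M.toReal :=
    norm_sum_sq_mul_le (antitone_exp_neg_mul hlam hv.le) (fun n => (Real.exp_pos _).le)
      (hexp v hv.le) (exp_mul_norm_dirichletSum_le hG h)
  refine iSup_le fun σ => iSup_le fun N => ?_
  have hσ : 0 ≤ (σ : ℝ) - 2 * v := sub_nonneg.2 σ.2
  have h3 := norm_sum_antitone_mul_le (antitone_exp_neg_mul hlam hσ)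
    (fun n => (Real.exp_pos _).le) (hexp _ hσ) h2 N
  have h4 : partialSum hG μ f σ N ω = ∑ n ∈ Finset.range N,
      ((Real.exp (-((σ : ℝ) - 2 * v) * lam n) : ℝ) : ℂ)
        * (((Real.exp (-v * lam n) ^ 2 : ℝ) : ℂ) * (c n * characterHom (hG.character n) ω)) := by
    refine Finset.sum_congr rfl fun n _ => ?_
    rw [← Real.exp_nat_mul, ← mul_assoc, ← Complex.ofReal_mul, ← Real.exp_add,
      show -((σ : ℝ) - 2 * v) * lam n + ((2 : ℕ) : ℝ) * (-v * lam n) = -σ * lam n by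
        push_cast; ring, characterHom_apply]
    ring
  rw [h4, ← ofReal_norm]
  refine (ENNReal.ofReal_le_ofReal h3).trans (le_of_eq ?_)
  rw [ENNReal.ofReal_mul zero_le_two, ENNReal.ofReal_toReal h, ENNReal.ofReal_ofNat]

theorem tendsto_partialSum (hlam : IsFrequency lam) {v : ℝ} (hv : 0 < v) {ω : G}
    (h : ⨆ n, dampedSum hG v (fun n => fourierCoefficient μ f (hG.character n)) n ω ≠ ⊤) :
    ∃ L : ℂ, Tendsto (fun N => partialSum hG μ f (2 * v) N ω) atTop (𝓝 L) := by
  simp_rw [partialSum_eq]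
  refine tendsto_sum_sq_mul (antitone_exp_neg_mul hlam hv.le) (fun n => (Real.exp_pos _).le) ?_
    (exp_mul_norm_dirichletSum_le hG h)
  simp_rw [neg_mul]
  exact Real.tendsto_exp_neg_atTop_nhds_zero.comp (hlam.tendsto_atTop.const_mul_atTop hv)

end Pointwise

end Group

end DirichletHardy
end

/-! ### The maximal theorem and almost everywhere convergence -/

theorem mainTheorem1 (lam : ℕ → ℝ) (hlam : DirichletHardy.IsFrequency lam)
    (hNC : DirichletHardy.NC lam) (u : ℝ) (hu : 0 < u) :
    ∃ C : ℝ, 0 < C ∧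
      ∀ (G : Type*) [CommGroup G] [TopologicalSpace G] [IsTopologicalGroup G] [CompactSpace G]
        [T2Space G] [MeasurableSpace G] [BorelSpace G]
        (μ : Measure G) [μ.IsHaarMeasure] [μ.Regular] [IsProbabilityMeasure μ]
        (β : Multiplicative ℝ →ₜ* G) (hG : DirichletHardy.IsDirichletGroup lam β)
        (p : ℝ≥0∞), 1 ≤ p → ∀ f : G → ℂ, DirichletHardy.MemHardy hG μ p f →
          eLpNorm (DirichletHardy.maximalFunction hG μ f u) p μ
              ≤ ENNReal.ofReal C * eLpNorm f p μ ∧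
          ∀ᵐ ω ∂μ, ∃ L : ℂ,
            Tendsto (fun N : ℕ => DirichletHardy.partialSum hG μ f u N ω) atTop (𝓝 L) := by
  obtain ⟨v, hv, rfl⟩ : ∃ v, 0 < v ∧ u = 2 * v := ⟨u / 2, half_pos hu, by ring⟩
  obtain ⟨K, hKt, hK⟩ := DirichletHardy.exists_eLpNorm_iSup_dampedSum_le hlam hNC hv
  -- The `2` is the Abel summation loss; the `+ 1` only makes the constant positive.
  refine ⟨2 * K.toReal + 1, by positivity, ?_⟩
  intro G _ _ _ _ _ _ _ μ _ _ _ β hG p hp f hf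
  have hmax := hf.eLpNorm_iSup_dampedSum_le μ hlam hv hp (hK G μ β hG p hp)
  set S : G → ℝ≥0∞ := fun ω => ⨆ n, DirichletHardy.dampedSum hG v
    (fun n => DirichletHardy.fourierCoefficient μ f (hG.character n)) n ω with hS
  have hSm : Measurable S := Measurable.iSup fun n =>
    DirichletHardy.measurable_dampedSum hG v _ n
  constructor
  · calc _ ≤ eLpNorm (S + S) p μ := eLpNorm_mono_enorm fun ω => by
          rw [enorm_eq_self, enorm_eq_self, Pi.add_apply, ← two_mul]
          exact DirichletHardy.maximalFunction_le μ hG f hlam hv ω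
      _ ≤ eLpNorm S p μ + eLpNorm S p μ :=
          eLpNorm_add_le hSm.aestronglyMeasurable hSm.aestronglyMeasurable hp
      _ ≤ K * eLpNorm f p μ + K * eLpNorm f p μ := add_le_add hmax hmax
      _ = ENNReal.ofReal (2 * K.toReal) * eLpNorm f p μ := by
          rw [← two_mul, ← mul_assoc, ENNReal.ofReal_mul zero_le_two,
            ENNReal.ofReal_toReal hKt, ENNReal.ofReal_ofNat]
      _ ≤ _ := by
          gcongr
          linarith
  -- On a probability space the `L_p` bound gives a finite `L_1` norm, hence `S` is finite almost
  -- everywhere.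
  · have hlt : ∫⁻ ω, S ω ∂μ < ⊤ := by
      have h1 := eLpNorm_le_eLpNorm_of_exponent_le hp hSm.aestronglyMeasurable (μ := μ)
      rw [eLpNorm_one_eq_lintegral_enorm] at h1
      simp only [enorm_eq_self] at h1
      exact (h1.trans hmax).trans_lt
        (ENNReal.mul_lt_top hKt.lt_top hf.memLp.eLpNorm_lt_top)
    filter_upwards [ae_lt_top hSm hlt.ne] with ω hω
    exact DirichletHardy.tendsto_partialSum μ hG f hlam hv hω.ne
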